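/- **Setting.** Let $V$ be a finite set of propositional variables, $F$ a finite set of clauses (finite sets of literals) over $V$, and $\zeta$ a real-valued weight function on the literals (negative weights are allowed). *CDCL with graph backtracking* works on a growing clause set (initially $F$), a trail $\pi$ (the assigned literals in order of assignment), the set $\tau\subseteq\pi$ of propagated literals and the queue $\omega=\pi\setminus\tau$ in trail order, and, for each assigned literal $\ell$: a justification $\rho(\ell)$ (a clause, or none for a decision), a decision level $\delta(\ell)$, the set $\gamma(\ell)$ of chunks containing $\ell$, and a set $\eta(\ell)$ of cross-chunks. These data are shared by $\ell$ and $\neg\ell$. For a set $S$ of literals, $\gamma(S)=\bigcup_{\ell\in S}\gamma(\ell)$ and $\delta(S)=\max_{\ell\in S}\delta(\ell)$ (with $\delta(\emptyset)=0$). A decision $d$ gets $\gamma(d)=\{ck_d\}$ and level $\delta(\pi)+1$; a literal $\ell$ implied by a clause $C$ gets $\rho(\ell)=C$, $\gamma(\ell)=\gamma(C\setminus\{\ell\})$ and $\delta(\ell)=\delta(C\setminus\{\ell\})$. The chunk $ck_d$ is the set of assigned literals $\ell$ with $ck_d\in\gamma(\ell)$, and its level is $\delta(d)$. Each clause of length at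 least two is watched by two of its literals. Initially the queue contains the literals of the unit clauses of $F$, as implied literals in no chunk; if an input clause of length at most one is falsified by them, it is the first conflict. *Propagation.* While $\omega\neq\emptyset$, take its first literal $\ell$, let $c_1=\neg\ell$, set $\eta(\ell)=\gamma(\ell)$, and inspect each clause $C$ watched by $c_1$; let $c_2$ be its other watched literal. If $c_2\in\pi$ and $\gamma(c_2)\subseteq\eta(c_1)$, go on to the next clause. Otherwise replace $c_1$ as a watched literal of $C$ by some $r\in C\setminus\{c_2\}$ that is not false, if there is one, and go on. If there is none, the new watched literal $r$ is some false literal of $C\setminus\{c_2\}$ (possibly $c_1$; if $c_2$ is also false, then $\neg r\notin\tau$). In that case, if $c_2$ is false, return the conflict $C$; if $c_2\in\pi$, add $\gamma(c_2)$ to $\eta(r)$; if $c_2$ is unassigned, append it to the trail as implied by $C$ and add $\gamma(c_2)$ to $\eta(r)$. When all these clauses have been inspected, add $\ell$ to $\tau$. *Main loop.* Propagate. If there is no conflict and all variables are assigned, return SAT; if there is no conflict and some variable is unassigned, decide an arbitrary unassigned literal. On a conflict $C$ with $\gamma(C)=\emptyset$, return UNSAT. Otherwise choose a set $\Gamma^*$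 of minimal weight $\sum_{\ell\in\pi,\ \gamma(\ell)\cap\Gamma^*\ne\emptyset}\zeta(\ell)$ among the *terminating backtrack candidates*: the sets $\Gamma_i$ of chunks of $\pi$ such that $|\Gamma_i\cap\gamma(C)|=1$ and such that the clause $\mathrm{1UIP}_{\Gamma_i}(C)$ is not in the current clause set or the chunk in $\Gamma_i\cap\gamma(C)$ has level $\delta(C)$. Here $\mathrm{1UIP}_{\Gamma_i}(C)$ is obtained from $C$ by traversing the trail from right to left and resolving on each literal of $\pi$ that lies in a chunk of $\Gamma_i$ and whose negation is in the current clause, with its justification, until exactly one literal of the current clause lies in a chunk of $\Gamma_i$. Then let $D=\mathrm{1UIP}_{\Gamma^*}(C)$; unassign every literal of a chunk in $\Gamma^*$; recompute, from left to right, the levels of the remaining literals; remove from $\tau$ each literal $\ell$ with $\eta(\ell)\cap\Gamma^*\neq\emptyset$; append the unique unassigned literal $c_2$ of $D$ to the trail as implied by $D$; add $D$ to the clause set; and, if $|D|\ge2$, let $D$ be watched by $c_2$ and any other literal $c_1\in D$, and add $\gamma(c_2)$ to $\eta(c_1)$. **Theorem (Graph backtracking).** For all $V$, $F$ and $\zeta$,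 and for all choices left open above (initial watched literals, order in which the clauses of a watch list are inspected, replacement literals, decisions, ties in the selection of $\Gamma^*$, the literal $c_1$), the algorithm can be started, and: 1. *(Soundness)* if it returns SAT, then $\pi$ is a total assignment that satisfies every clause of $F$; if it returns UNSAT, then the empty clause is derivable from $F$ by binary resolution, and $F$ is unsatisfiable; 2. *(Completeness)* no execution gets stuck: every execution that cannot be continued has returned SAT if $F$ is satisfiable, and has returned UNSAT if $F$ is unsatisfiable; 3. *(Termination)* there is no infinite execution. -/

import Mathlib

namespace GraphBT

/-! ### Propositional logic -/

/-- A literal over the variables `V`: a variable together with a sign (`true` = positive). -/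
abbrev Lit (V : Type*) := V × Bool

/-- The complement of a literal. -/
def neg {V : Type*} (l : Lit V) : Lit V := (l.1, !l.2)

/-- A clause is a finite (disjunctive) set of literals. -/
abbrev Clause (V : Type*) := Finset (Lit V)

/-- A CNF formula is a finite (conjunctive) set of clauses. -/
abbrev CNF (V : Type*) := Finset (Clause V)

/-- The total assignment `a` satisfies every clause of `F`. -/
def Satisfies {V : Type*} (a : V → Bool) (F : CNF V) : Prop :=
  ∀ C ∈ F, ∃ l ∈ C, a l.1 = l.2

def Satisfiable {V : Type*} (F : CNF V) : Prop := ∃ a : V → Bool, Satisfies a F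

/-- Binary resolution of `C` and `D` over `l`, where `neg l ∈ C` and `l ∈ D`. -/
def resolve {V : Type*} [DecidableEq V] (l : Lit V) (C D : Clause V) : Clause V :=
  C.erase (neg l) ∪ D.erase l

/-- The clauses derivable from `F` by binary resolution. -/
inductive Derivable {V : Type*} [DecidableEq V] (F : CNF V) : Clause V → Prop
  | ax {C : Clause V} : C ∈ F → Derivable F C
  | res {C D : Clause V} {l : Lit V} : Derivable F C → Derivable F D →
      neg l ∈ C → l ∈ D → Derivable F (resolve l C D)

/-! ### Solver states -/

/-- A chunk is named by its decision literal: `l` names the chunk `ck_l`. -/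
abbrev Chunk (V : Type*) := Lit V

/-- Program points.
* `loop`: the test of the `while` loop of unit propagation (entered from the main loop);
* `visit l P`: propagating `l`; the clauses `P` watched by `neg l` are still to be inspected;
* `conflict C`: unit propagation has returned the conflict clause `C`;
* `sat`, `unsat`: the algorithm has returned. -/
inductive Control (V : Type*)
  | loop
  | visit (l : Lit V) (P : Finset (Clause V))
  | conflict (C : Clause V)
  | sat
  | unsat

/-- A state of the solver. The functions `reason`, `level`, `chunks` and `cross` agree on a
literal and its complement, and are therefore stored per variable. -/
structure State (V : Type*) where
  /-- the clause set: input clauses and learned clauses -/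
  clauses : CNF V
  /-- the trail `π`, in order of assignment -/
  trail : List (Lit V)
  /-- the set `τ` of propagated literals of the trail -/
  propagated : Finset (Lit V)
  /-- the justification; `none` for decisions and for unassigned variables -/
  reason : V → Option (Clause V)
  /-- the decision level `δ`, which is `⊤` for unassigned variables -/
  level : V → ℕ∞
  /-- the set `γ` of chunks to which a literal belongs -/
  chunks : V → Finset (Chunk V)
  /-- the cross-chunks `η` of a literal -/
  cross : V → Finset (Chunk V)
  /-- the two watched literals of a clause (meaningful for clauses of length at least two) -/
  watch : Clause V → Finset (Lit V)
  /-- the program point -/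
  control : Control V

noncomputable section
variable {V : Type*} [DecidableEq V]

namespace State

/-- The queue `ω` of assigned literals that have not been propagated, in trail order. -/
def queue (s : State V) : List (Lit V) := s.trail.filter (fun l => l ∉ s.propagated)

def Unassigned (s : State V) (l : Lit V) : Prop := l ∉ s.trail ∧ neg l ∉ s.trail

/-- The clauses watched by `l`. -/
def watchList (s : State V) (l : Lit V) : Finset (Clause V) :=
  s.clauses.filter (fun C => 2 ≤ C.card ∧ l ∈ s.watch C)

/-- `γ(S)` for a set `S` of literals. -/
def chunksOf (s : State V) (S : Finset (Lit V)) : Finset (Chunk V) :=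
  S.biUnion (fun l => s.chunks l.1)

/-- `δ(S)` for a set `S` of literals; the level of the empty set is `0`. -/
def levelOf (s : State V) (S : Finset (Lit V)) : ℕ∞ := S.sup (fun l => s.level l.1)

/-- The level of a set of chunks; the level of a chunk is that of its decision literal. -/
def chunkLevel (s : State V) (G : Finset (Chunk V)) : ℕ∞ := G.sup (fun d => s.level d.1)

/-- The literal `l` belongs to one of the chunks in `G`. -/
def Touches (s : State V) (G : Finset (Chunk V)) (l : Lit V) : Prop :=
  (s.chunks l.1 ∩ G).Nonempty

instance (s : State V) (G : Finset (Chunk V)) : DecidablePred (s.Touches G) :=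
  fun _ => inferInstanceAs (Decidable (Finset.Nonempty _))

/-! ### Conflict analysis -/

/-- Conflict analysis along the given list of literals, with current clause `D`: resolve away the
literals of `D` that belong to `G`, and stop as soon as exactly one of them is left. The result is
`none` if this fails. -/
def analyzeAlong (s : State V) (G : Finset (Chunk V)) : List (Lit V) → Clause V → Option (Clause V)
  | [], D => if (D.filter (s.Touches G)).card = 1 then some D else none
  | l :: rest, D =>
      if (D.filter (s.Touches G)).card = 1 then some D
      else if neg l ∈ D ∧ s.Touches G l then
        match s.reason l.1 with
        | none => none
        | some R => s.analyzeAlong G rest (resolve l D R)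
      else s.analyzeAlong G rest D

/-- The first unique implication point of the conflict clause `C` with respect to the chunks `G`;
the trail is traversed from right to left. -/
def analyze (s : State V) (C : Clause V) (G : Finset (Chunk V)) : Option (Clause V) :=
  s.analyzeAlong G s.trail.reverse C

/-! ### Chunk selection -/

/-- `G` is a terminating backtrack candidate for the conflict clause `C`. -/
def IsCandidate (s : State V) (C : Clause V) (G : Finset (Chunk V)) : Prop :=
  G ⊆ s.chunksOf s.trail.toFinset ∧ (G ∩ s.chunksOf C).card = 1 ∧
    ((¬ ∃ D ∈ s.clauses, s.analyze C G = some D) ∨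
      s.chunkLevel (G ∩ s.chunksOf C) = s.levelOf C)

/-- The total weight of the assigned literals that belong to the chunks `G`. -/
def weight (s : State V) (ζ : Lit V → ℝ) (G : Finset (Chunk V)) : ℝ :=
  ∑ l ∈ s.trail.toFinset.filter (s.Touches G), ζ l

/-- `G` is a terminating backtrack candidate of least weight. -/
def IsSelected (s : State V) (ζ : Lit V → ℝ) (C : Clause V) (G : Finset (Chunk V)) : Prop :=
  s.IsCandidate C G ∧ ∀ G', s.IsCandidate C G' → s.weight ζ G ≤ s.weight ζ G'

/-! ### Backtracking -/

/-- The decision level of an assigned literal, recomputed from the trail and the levels of the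
literals in its justification. -/
def updateLevel (s : State V) (l : Lit V) : ℕ∞ :=
  match s.reason l.1 with
  | none => ((s.trail.takeWhile (fun m => m ≠ l)).countP (fun m => (s.reason m.1).isNone) : ℕ) + 1
  | some R => s.levelOf (R.erase l)

/-- The body of the loop of the backtracking procedure. -/
def undoLit (G : Finset (Chunk V)) (s : State V) (l : Lit V) : State V :=
  if s.Touches G l then
    { s with
      trail := s.trail.erase l
      chunks := Function.update s.chunks l.1 ∅
      reason := Function.update s.reason l.1 none
      level := Function.update s.level l.1 ⊤ }
  else
    { s with
      level := Function.update s.level l.1 (s.updateLevel l)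
      propagated :=
        if (s.cross l.1 ∩ G).Nonempty then s.propagated.erase l else s.propagated }

/-- Backtracking: undo the chunks `G`; the trail is traversed from left to right. -/
def undo (s : State V) (G : Finset (Chunk V)) : State V :=
  let t := s.trail.foldl (undoLit G) s
  { t with propagated := t.propagated ∩ t.trail.toFinset }

/-! ### Elementary updates -/

/-- Append to the trail the literal `l`, implied by the clause `C`. -/
def imply (s : State V) (l : Lit V) (C : Clause V) : State V :=
  { s with
    trail := s.trail ++ [l]
    reason := Function.update s.reason l.1 (some C)
    level := Function.update s.level l.1 (s.levelOf (C.erase l))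
    chunks := Function.update s.chunks l.1 (s.chunksOf (C.erase l)) }

/-- Append the decision `l` to the trail. -/
def decide (s : State V) (l : Lit V) : State V :=
  { s with
    trail := s.trail ++ [l]
    reason := Function.update s.reason l.1 none
    level := Function.update s.level l.1 (s.levelOf s.trail.toFinset + 1)
    chunks := Function.update s.chunks l.1 {l} }

/-- Make `a` and `b` the watched literals of `C`. -/
def setWatch (s : State V) (C : Clause V) (a b : Lit V) : State V :=
  { s with watch := Function.update s.watch C {a, b} }

/-- Add the chunks of `c` to the cross-chunks of `r`. -/
def addCross (s : State V) (r c : Lit V) : State V :=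
  { s with cross := Function.update s.cross r.1 (s.cross r.1 ∪ s.chunks c.1) }

def goto (s : State V) (k : Control V) : State V := { s with control := k }

/-- Add the clause `D` to the clause set. -/
def addClause (s : State V) (D : Clause V) : State V :=
  { s with clauses := insert D s.clauses }

/-- `r` may be returned when a replacement is searched for the false watched literal of `C` whose
complement is being propagated; `c₂` is the other watched literal. A non-false literal is returned
if there is one. Otherwise `r` is a false literal, for instance the old watched literal itself; if
`C` is falsified, then `neg r` must not have been propagated already. -/
def IsReplacement (s : State V) (C : Clause V) (c₂ r : Lit V) : Prop :=
  r ∈ C ∧ r ≠ c₂ ∧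
    ((∃ q ∈ C, q ≠ c₂ ∧ neg q ∉ s.trail) → neg r ∉ s.trail) ∧
    (neg c₂ ∈ s.trail → neg r ∉ s.propagated)

end State

/-! ### The algorithm -/

/-- The states in which the main loop may be entered for the input formula `F`. Every clause of
length at least two is watched by two of its literals. Clauses of length one are put in the queue
as implied literals that belong to no chunk; if an input clause of length at most one is falsified
by these, it is the first conflict. -/
structure Initial (F : CNF V) (s : State V) : Prop where
  clauses : s.clauses = F
  propagated : s.propagated = ∅
  chunks : ∀ v, s.chunks v = ∅
  cross : ∀ v, s.cross v = ∅
  watch : ∀ C ∈ F, 2 ≤ C.card → ∃ a ∈ C, ∃ b ∈ C, a ≠ b ∧ s.watch C = {a, b}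
  nodup : s.trail.Nodup
  units : ∀ l ∈ s.trail, {l} ∈ F ∧ neg l ∉ s.trail
  assigned : ∀ l ∈ s.trail, s.reason l.1 = some {l} ∧ s.level l.1 = 0
  unassigned : ∀ l, s.Unassigned l → s.reason l.1 = none ∧ s.level l.1 = ⊤
  control :
    (s.control = .loop ∧ ∀ C ∈ F, C.card ≤ 1 → ∃ l ∈ C, l ∈ s.trail) ∨
    (∃ C ∈ F, C.card ≤ 1 ∧ (∀ l ∈ C, neg l ∈ s.trail) ∧ s.control = .conflict C)

/-- One step of conflict-driven clause learning with graph backtracking, with weights `ζ`. -/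
inductive Step [Fintype V] (ζ : Lit V → ℝ) : State V → State V → Prop
  /-- Everything is propagated and all variables are assigned. -/
  | sat {s : State V} :
      s.control = .loop → s.queue = [] → s.trail.length = Fintype.card V →
      Step ζ s (s.goto .sat)
  /-- Everything is propagated and some variable is unassigned: take any decision. -/
  | decide {s : State V} {l : Lit V} :
      s.control = .loop → s.queue = [] → s.trail.length ≠ Fintype.card V →
      s.Unassigned l →
      Step ζ s (s.decide l)
  /-- Start propagating the first literal of the queue, and reset its cross-chunks. -/
  | start {s : State V} {l : Lit V} {q : List (Lit V)} :
      s.control = .loop → s.queue = l :: q →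
      Step ζ s (State.goto { s with cross := Function.update s.cross l.1 (s.chunks l.1) }
        (.visit l (s.watchList (neg l))))
  /-- All clauses watched by `neg l` have been inspected: `l` is propagated. -/
  | finish {s : State V} {l : Lit V} :
      s.control = .visit l ∅ →
      Step ζ s (State.goto { s with propagated := insert l s.propagated } .loop)
  /-- The inspected clause is satisfied by its other watched literal `c₂`, for long enough. -/
  | skip {s : State V} {l c₂ : Lit V} {P : Finset (Clause V)} {C : Clause V} :
      s.control = .visit l P → C ∈ P → s.watch C = {neg l, c₂} →
      c₂ ∈ s.trail ∧ s.chunks c₂.1 ⊆ s.cross l.1 →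
      Step ζ s (s.goto (.visit l (P.erase C)))
  /-- A good replacement `r` is found. -/
  | replace {s : State V} {l c₂ r : Lit V} {P : Finset (Clause V)} {C : Clause V} :
      s.control = .visit l P → C ∈ P → s.watch C = {neg l, c₂} →
      ¬ (c₂ ∈ s.trail ∧ s.chunks c₂.1 ⊆ s.cross l.1) →
      s.IsReplacement C c₂ r → neg r ∉ s.trail →
      Step ζ s ((s.setWatch C r c₂).goto (.visit l (P.erase C)))
  /-- The clause is falsified. -/
  | conflict {s : State V} {l c₂ r : Lit V} {P : Finset (Clause V)} {C : Clause V} :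
      s.control = .visit l P → C ∈ P → s.watch C = {neg l, c₂} →
      ¬ (c₂ ∈ s.trail ∧ s.chunks c₂.1 ⊆ s.cross l.1) →
      s.IsReplacement C c₂ r → neg r ∈ s.trail → neg c₂ ∈ s.trail →
      Step ζ s ((s.setWatch C r c₂).goto (.conflict C))
  /-- The clause is a missed implication of `c₂`. -/
  | missed {s : State V} {l c₂ r : Lit V} {P : Finset (Clause V)} {C : Clause V} :
      s.control = .visit l P → C ∈ P → s.watch C = {neg l, c₂} →
      ¬ (c₂ ∈ s.trail ∧ s.chunks c₂.1 ⊆ s.cross l.1) →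
      s.IsReplacement C c₂ r → neg r ∈ s.trail → c₂ ∈ s.trail →
      Step ζ s (((s.setWatch C r c₂).addCross r c₂).goto (.visit l (P.erase C)))
  /-- The clause implies `c₂`. -/
  | imply {s : State V} {l c₂ r : Lit V} {P : Finset (Clause V)} {C : Clause V} :
      s.control = .visit l P → C ∈ P → s.watch C = {neg l, c₂} →
      ¬ (c₂ ∈ s.trail ∧ s.chunks c₂.1 ⊆ s.cross l.1) →
      s.IsReplacement C c₂ r → neg r ∈ s.trail → s.Unassigned c₂ →
      Step ζ s ((((s.setWatch C r c₂).imply c₂ C).addCross r c₂).goto (.visit l (P.erase C)))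
  /-- The conflict clause belongs to no chunk. -/
  | unsat {s : State V} {C : Clause V} :
      s.control = .conflict C → s.chunksOf C = ∅ →
      Step ζ s (s.goto .unsat)
  /-- Select chunks, analyze the conflict, undo the selected chunks, learn a clause `D` of length
  one, and assign its unassigned literal. -/
  | learnUnit {s : State V} {C D : Clause V} {G : Finset (Chunk V)} {c₂ : Lit V} :
      s.control = .conflict C → s.chunksOf C ≠ ∅ →
      s.IsSelected ζ C G → s.analyze C G = some D →
      (∀ m ∈ D, (s.undo G).Unassigned m ↔ m = c₂) → c₂ ∈ D → D.card < 2 →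
      Step ζ s ((((s.undo G).imply c₂ D).addClause D).goto .loop)
  /-- The same for a learned clause of length at least two: it is watched by its unassigned
  literal `c₂` and any other of its literals. -/
  | learn {s : State V} {C D : Clause V} {G : Finset (Chunk V)} {c₁ c₂ : Lit V} :
      s.control = .conflict C → s.chunksOf C ≠ ∅ →
      s.IsSelected ζ C G → s.analyze C G = some D →
      (∀ m ∈ D, (s.undo G).Unassigned m ↔ m = c₂) → c₂ ∈ D → 2 ≤ D.card →
      c₁ ∈ D → c₁ ≠ c₂ →
      Step ζ s ((((((s.undo G).imply c₂ D).addClause D).setWatch D c₁ c₂).addCross c₁ c₂).goto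
        .loop)

/-- `s` is reached by some execution of the algorithm on `F` with weights `ζ`. -/
def Reachable [Fintype V] (ζ : Lit V → ℝ) (F : CNF V) (s : State V) : Prop :=
  ∃ s₀, Initial F s₀ ∧ Relation.ReflTransGen (Step ζ) s₀ s

/-- No step is possible in `s`: an execution that reaches `s` ends there. -/
def Final [Fintype V] (ζ : Lit V → ℝ) (s : State V) : Prop := ∀ s', ¬ Step ζ s s'

end

end GraphBT

open GraphBT

namespace GraphBT
variable {V : Type*}

/-! ### Literals and lists -/

/-! A chunk collects the consequences of one decision, and an implied literal inherits the chunks of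
all its premises. Hence a literal outside the chunks `G` has all its premises outside them, and
removing whatever touches `G` leaves a justified trail (`TrailInv.undo`).

Conflict analysis succeeds because `G` meets the chunks of the conflict clause in a single chunk,
whose decision precedes its other members. The result is derivable, falsified, and has exactly one
literal touching `G`, so exactly one literal becomes unassigned (`analyze_spec`, `conflict_spec`).
If the conflict lies in no chunk, resolution ends in the empty clause (`derivable_empty`).

The watch invariant is the field `other` of `Base`: once `neg a` is propagated, the other watch `b`
is true and its chunks lie among the cross-chunks of `a`. Backtracking unpropagates every literal
whose cross-chunks meet `G`, so the invariant survives. On a total, fully propagated trail it makes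
every clause true (`Inv.sat`). No execution gets stuck, since a single chunk of greatest level in
the conflict is always a candidate (`Inv.final`); the weights matter nowhere else.

For termination, consider the time between a decision `d` and the next conflict (`Fresh`). Every
unpropagated literal then lies in the chunk of `d`, which has the greatest level. If the learned
clause were already known, candidacy would force `d ∈ G`; both its watches are false, hence
unpropagated, hence both touch `G`, contradicting uniqueness. So the first conflict after a decision
learns one of finitely many new clauses (`Inv.notMem_of_fresh`). A later conflict that learns
nothing new deletes a decision and adds none. A lexicographic measure combines these facts
(`progress`). -/

@[simp] theorem neg_fst (l : Lit V) : (neg l).1 = l.1 := rfl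

@[simp] theorem neg_neg (l : Lit V) : neg (neg l) = l := by simp [neg]

theorem neg_ne (l : Lit V) : neg l ≠ l := fun h => by
  have := congrArg Prod.snd h
  simp [neg] at this

theorem neg_eq_iff {l m : Lit V} : neg l = m ↔ l = neg m :=
  ⟨fun h => by rw [← h, neg_neg], fun h => by rw [h, neg_neg]⟩

theorem eq_or_eq_neg {l m : Lit V} (h : l.1 = m.1) : l = m ∨ l = neg m := by
  obtain ⟨v, a⟩ := l
  obtain ⟨w, b⟩ := m
  obtain rfl : v = w := h
  cases a <;> cases b <;> simp [neg]

/-- The sublist `[a, b]` expresses that `a` occurs before `b`; as `b` occurs only once, splitting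
the list at `b` puts `a` in the prefix. The order of the trail is used in this form. -/
theorem mem_of_pair_sublist {α : Type*} {a b : α} {p q : List α} (hd : (p ++ b :: q).Nodup)
    (h : [a, b].Sublist (p ++ b :: q)) : a ∈ p := by
  rw [List.nodup_append] at hd
  obtain ⟨l₁, l₂, he, h₁, h₂⟩ := List.sublist_append_iff.1 h
  match l₁, he with
  | [], he =>
    simp only [List.nil_append] at he
    subst he
    have hb : b ∈ q := by
      cases h₂ with
      | cons _ h => exact h.subset (by simp)
      | cons_cons _ h => exact h.subset (by simp)
    exact absurd hb (List.nodup_cons.1 hd.2.1).1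
  | x :: _, he =>
    simp only [List.cons_append, List.cons.injEq] at he
    obtain ⟨rfl, -⟩ := he
    exact h₁.subset (by simp)

theorem not_pair_sublist {α : Type*} {a b : α} {p q : List α} (hd : (p ++ b :: q).Nodup)
    (ha : a ∈ p) : ¬ [b, a].Sublist (p ++ b :: q) := by
  intro h
  obtain ⟨u, v, rfl⟩ := List.append_of_mem ha
  simp only [List.append_assoc, List.cons_append] at h hd
  have hb : b ∈ u := mem_of_pair_sublist hd h
  rw [List.nodup_append] at hd
  exact hd.2.2 b hb b (by simp) rfl

theorem pair_sublist_append {α : Type*} {a b : α} {t : List α} (ha : a ∈ t) :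
    [a, b].Sublist (t ++ [b]) :=
  (List.singleton_sublist.2 ha).append (List.Sublist.refl [b])

namespace State

theorem Unassigned.fst_ne {s : State V} {l m : Lit V} (h : s.Unassigned l) (hm : m ∈ s.trail) :
    m.1 ≠ l.1 := fun e => by
  rcases eq_or_eq_neg e with rfl | rfl
  · exact h.1 hm
  · exact h.2 hm

theorem levelOf_ne_top {s : State V} {C : Finset (Lit V)} (hC : ∀ m ∈ C, s.level m.1 ≠ ⊤) :
    s.levelOf C ≠ ⊤ := by
  unfold levelOf
  rw [← lt_top_iff_ne_top, Finset.sup_lt_iff (by simp)]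
  exact fun m hm => lt_top_iff_ne_top.2 (hC m hm)

end State

variable [DecidableEq V]

namespace State

theorem mem_chunksOf {s : State V} {S : Finset (Lit V)} {d : Chunk V} :
    d ∈ s.chunksOf S ↔ ∃ m ∈ S, d ∈ s.chunks m.1 := by simp [chunksOf]

theorem touches_iff {s : State V} {G : Finset (Chunk V)} {l : Lit V} :
    s.Touches G l ↔ ∃ d ∈ s.chunks l.1, d ∈ G := by
  simp [Touches, Finset.Nonempty]

end State

open State

/-! ### Invariants of the trail -/

/-- The trail is a consistent list without repetitions; justifications precede the literals they
imply; chunks and levels are those given by the justifications. -/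
structure TrailInv (s : State V) : Prop where
  nodup : s.trail.Nodup
  consistent : ∀ l ∈ s.trail, neg l ∉ s.trail
  implied : ∀ l ∈ s.trail, ∀ R, s.reason l.1 = some R →
    l ∈ R ∧ (∀ m ∈ R, m ≠ l → [neg m, l].Sublist s.trail) ∧ s.chunks l.1 = s.chunksOf (R.erase l)
  decision : ∀ l ∈ s.trail, s.reason l.1 = none → s.chunks l.1 = {l}
  chunk : ∀ l ∈ s.trail, ∀ d ∈ s.chunks l.1,
    d ∈ s.trail ∧ s.reason d.1 = none ∧ (d = l ∨ [d, l].Sublist s.trail)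
  level : ∀ l ∈ s.trail, s.level l.1 = s.chunkLevel (s.chunks l.1) ∧ s.level l.1 ≠ ⊤

namespace TrailInv
variable {s t : State V}

theorem congr (h : TrailInv s) (ht : t.trail = s.trail) (hr : t.reason = s.reason)
    (hc : t.chunks = s.chunks) (hl : t.level = s.level) : TrailInv t := by
  obtain ⟨h1, h2, h3, h4, h5, h6⟩ := h
  constructor <;> simp only [chunksOf, chunkLevel, ht, hr, hc, hl] <;> assumption

theorem eq_of_fst_eq (h : TrailInv s) {l m : Lit V} (hl : l ∈ s.trail) (hm : m ∈ s.trail)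
    (e : l.1 = m.1) : l = m := by
  rcases eq_or_eq_neg e with rfl | rfl
  · rfl
  · exact absurd hl (h.consistent m hm)

theorem map_fst_nodup (h : TrailInv s) : (s.trail.map Prod.fst).Nodup :=
  List.Nodup.map_on (fun _ ha _ hb e => h.eq_of_fst_eq ha hb e) h.nodup

/-- Levels are suprema over chunks, and the chunks of a clause form a union. This lets the level of
a conflict be compared with that of a chunk. -/
theorem levelOf_eq (h : TrailInv s) {C : Clause V} (hC : ∀ m ∈ C, neg m ∈ s.trail) :
    s.levelOf C = s.chunkLevel (s.chunksOf C) := by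
  unfold levelOf chunkLevel chunksOf
  rw [Finset.sup_biUnion]
  exact Finset.sup_congr rfl fun m hm => (h.level _ (hC m hm)).1

/-- The variable of `l` occurs in no trail literal, premise or chunk name, so all old data are
unchanged, and `l` comes after its premises. -/
theorem imply (h : TrailInv s) {l : Lit V} {C : Clause V} (hl : s.Unassigned l) (hlC : l ∈ C)
    (hC : ∀ m ∈ C, m ≠ l → neg m ∈ s.trail) : TrailInv (s.imply l C) := by
  have hC' : ∀ m ∈ C.erase l, neg m ∈ s.trail := fun m hm =>
    hC m (Finset.mem_of_mem_erase hm) (Finset.ne_of_mem_erase hm)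
  have hne : ∀ m ∈ s.trail, m.1 ≠ l.1 := fun m hm => hl.fst_ne hm
  have hne' : ∀ m ∈ C.erase l, m.1 ≠ l.1 := fun m hm => hne (neg m) (hC' m hm)
  have hchunks : ∀ S : Finset (Lit V), (∀ m ∈ S, m.1 ≠ l.1) →
      (s.imply l C).chunksOf S = s.chunksOf S := fun S hS => by
    unfold chunksOf
    exact Finset.biUnion_congr rfl fun m hm => by simp [State.imply, hS m hm]
  have hlevel : ∀ m ∈ s.trail, (s.imply l C).chunkLevel (s.chunks m.1) =
      s.chunkLevel (s.chunks m.1) := fun m hm => by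
    unfold chunkLevel
    exact Finset.sup_congr rfl fun d hd => by
      simp [State.imply, hne d (h.chunk m hm d hd).1]
  have hmem : ∀ m, m ∈ (s.imply l C).trail ↔ m ∈ s.trail ∨ m = l := by simp [State.imply]
  have hsub : s.trail.Sublist (s.imply l C).trail := List.sublist_append_left _ _
  refine ⟨?_, ?_, ?_, ?_, ?_, ?_⟩
  · simp only [State.imply, List.nodup_append, h.nodup, List.nodup_singleton, true_and]
    intro a ha b hb
    simp only [List.mem_singleton] at hb
    subst hb
    exact fun e => hl.1 (e ▸ ha)
  · intro m hm hm'
    rw [hmem] at hm hm'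
    rcases hm with hm | rfl <;> rcases hm' with hm' | hm'
    · exact h.consistent m hm hm'
    · exact hne m hm (by rw [← hm']; rfl)
    · exact hl.2 hm'
    · exact neg_ne _ hm'
  · intro m hm R hR
    rcases (hmem m).1 hm with hm | rfl
    · have hRs : s.reason m.1 = some R := by simpa [State.imply, hne m hm] using hR
      obtain ⟨h1, h2, h3⟩ := h.implied m hm R hRs
      refine ⟨h1, fun k hk hkm => (h2 k hk hkm).trans hsub, ?_⟩
      rw [hchunks _ fun k hk => hne (neg k) ((h2 k (Finset.mem_of_mem_erase hk)
        (Finset.ne_of_mem_erase hk)).subset (by simp)), ← h3]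
      simp [State.imply, hne m hm]
    · obtain rfl : C = R := by simpa [State.imply] using hR
      refine ⟨hlC, fun k hk hkm => pair_sublist_append (hC k hk hkm), ?_⟩
      rw [hchunks _ hne']
      simp [State.imply]
  · intro m hm hr
    rcases (hmem m).1 hm with hm | rfl
    · simp only [State.imply, ne_eq, hne m hm, not_false_eq_true, Function.update_of_ne] at hr ⊢
      exact h.decision m hm hr
    · simp [State.imply] at hr
  · have key : ∀ m ∈ s.trail, ∀ d ∈ s.chunks m.1, d ∈ (s.imply l C).trail ∧
        (s.imply l C).reason d.1 = none ∧ (d = m ∨ [d, m].Sublist s.trail) := fun m hm d hd => by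
      obtain ⟨h1, h2, h3⟩ := h.chunk m hm d hd
      exact ⟨hsub.subset h1, by simp [State.imply, hne d h1, h2], h3⟩
    intro m hm d hd
    rcases (hmem m).1 hm with hm | rfl
    · have hd' : d ∈ s.chunks m.1 := by simpa [State.imply, hne m hm] using hd
      obtain ⟨h1, h2, h3⟩ := key m hm d hd'
      exact ⟨h1, h2, h3.imp_right fun h => h.trans hsub⟩
    · have hd' : d ∈ s.chunksOf (C.erase m) := by simpa [State.imply] using hd
      obtain ⟨k, hk, hdk⟩ := mem_chunksOf.1 hd'
      obtain ⟨h1, h2, h3⟩ := key (neg k) (hC' k hk) d hdk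
      exact ⟨h1, h2, Or.inr (pair_sublist_append (h.chunk (neg k) (hC' k hk) d hdk).1)⟩
  · intro m hm
    rcases (hmem m).1 hm with hm | rfl
    · have e1 : (s.imply l C).level m.1 = s.level m.1 := by simp [State.imply, hne m hm]
      have e2 : (s.imply l C).chunks m.1 = s.chunks m.1 := by simp [State.imply, hne m hm]
      rw [e1, e2, hlevel m hm]
      exact h.level m hm
    · have e1 : (s.imply m C).level m.1 = s.levelOf (C.erase m) := by simp [State.imply]
      have e2 : (s.imply m C).chunks m.1 = s.chunksOf (C.erase m) := by simp [State.imply]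
      rw [e1, e2, h.levelOf_eq hC']
      refine ⟨?_, ?_⟩
      · unfold chunkLevel
        refine Finset.sup_congr rfl fun d hd => ?_
        obtain ⟨k, hk, hdk⟩ := mem_chunksOf.1 hd
        simp [State.imply, hne d (h.chunk (neg k) (hC' k hk) d hdk).1]
      · rw [← h.levelOf_eq hC']
        exact levelOf_ne_top fun k hk => (h.level _ (hC' k hk)).2

theorem decide (h : TrailInv s) {l : Lit V} (hl : s.Unassigned l) : TrailInv (s.decide l) := by
  have hne : ∀ m ∈ s.trail, m.1 ≠ l.1 := fun m hm => hl.fst_ne hm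
  have hmem : ∀ m, m ∈ (s.decide l).trail ↔ m ∈ s.trail ∨ m = l := by simp [State.decide]
  have hsub : s.trail.Sublist (s.decide l).trail := List.sublist_append_left _ _
  refine ⟨?_, ?_, ?_, ?_, ?_, ?_⟩
  · simp only [State.decide, List.nodup_append, h.nodup, List.nodup_singleton, true_and]
    intro a ha b hb
    simp only [List.mem_singleton] at hb
    subst hb
    exact fun e => hl.1 (e ▸ ha)
  · intro m hm hm'
    rw [hmem] at hm hm'
    rcases hm with hm | rfl <;> rcases hm' with hm' | hm'
    · exact h.consistent m hm hm'
    · exact hne m hm (by rw [← hm']; rfl)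
    · exact hl.2 hm'
    · exact neg_ne _ hm'
  · intro m hm R hR
    rcases (hmem m).1 hm with hm | rfl
    · have hRs : s.reason m.1 = some R := by simpa [State.decide, hne m hm] using hR
      obtain ⟨h1, h2, h3⟩ := h.implied m hm R hRs
      refine ⟨h1, fun k hk hkm => (h2 k hk hkm).trans hsub, ?_⟩
      have : (s.decide l).chunks m.1 = s.chunks m.1 := by simp [State.decide, hne m hm]
      rw [this, h3]
      unfold chunksOf
      refine Finset.biUnion_congr rfl fun k hk => ?_
      have : k.1 ≠ l.1 := hne (neg k) ((h2 k (Finset.mem_of_mem_erase hk)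
        (Finset.ne_of_mem_erase hk)).subset (by simp))
      simp [State.decide, this]
    · simp [State.decide] at hR
  · intro m hm hr
    rcases (hmem m).1 hm with hm | rfl
    · simp only [State.decide, ne_eq, hne m hm, not_false_eq_true, Function.update_of_ne] at hr ⊢
      exact h.decision m hm hr
    · simp [State.decide]
  · intro m hm d hd
    rcases (hmem m).1 hm with hm | rfl
    · have hd' : d ∈ s.chunks m.1 := by simpa [State.decide, hne m hm] using hd
      obtain ⟨h1, h2, h3⟩ := h.chunk m hm d hd'
      exact ⟨hsub.subset h1, by simp [State.decide, hne d h1, h2],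
        h3.imp_right fun h => h.trans hsub⟩
    · obtain rfl : d = m := by simpa [State.decide] using hd
      exact ⟨hm, by simp [State.decide], Or.inl rfl⟩
  · intro m hm
    rcases (hmem m).1 hm with hm | rfl
    · have e1 : (s.decide l).level m.1 = s.level m.1 := by simp [State.decide, hne m hm]
      have e2 : (s.decide l).chunks m.1 = s.chunks m.1 := by simp [State.decide, hne m hm]
      rw [e1, e2, (h.level m hm).1]
      refine ⟨?_, (h.level m hm).1 ▸ (h.level m hm).2⟩
      unfold chunkLevel
      exact Finset.sup_congr rfl fun d hd => by
        simp [State.decide, hne d (h.chunk m hm d hd).1]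
    · have e1 : (s.decide m).level m.1 = s.levelOf s.trail.toFinset + 1 := by simp [State.decide]
      have e2 : (s.decide m).chunks m.1 = {m} := by simp [State.decide]
      rw [e2]
      -- The only chunk of a decision is its own, so the level equation is trivial; what remains is
      -- finiteness.
      refine ⟨by simp [chunkLevel], ?_⟩
      rw [e1]
      have : s.levelOf s.trail.toFinset ≠ ⊤ := levelOf_ne_top fun k hk =>
        (h.level k (List.mem_toFinset.1 hk)).2
      simpa using this

end TrailInv

/-! ### Backtracking -/

/-- The state `t` is obtained from `s` by undoing the chunks `G` along the part `p` of the
trail; the part `q` has not been treated. -/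
structure UndoAlong (s : State V) (G : Finset (Chunk V)) (p q : List (Lit V)) (t : State V) :
    Prop where
  trail : t.trail = p.filter (fun l => ¬ s.Touches G l) ++ q
  clauses : t.clauses = s.clauses
  cross : t.cross = s.cross
  watch : t.watch = s.watch
  chunks : ∀ m ∈ s.trail, (m ∈ p → ¬ s.Touches G m) → t.chunks m.1 = s.chunks m.1
  reason : ∀ m ∈ s.trail, (m ∈ p → ¬ s.Touches G m) → t.reason m.1 = s.reason m.1
  propagated : ∀ m ∈ t.propagated, m ∈ s.propagated ∧
    (m ∈ p → ¬ s.Touches G m → s.cross m.1 ∩ G = ∅)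
  level : ∀ m ∈ p, ¬ s.Touches G m →
    t.level m.1 = t.chunkLevel (s.chunks m.1) ∧ t.level m.1 ≠ ⊤

/-- The names of the chunks of an earlier literal are themselves earlier, so the update at `l`
disturbs no level already recomputed. If `l` survives, its premises are earlier and survive too, so
their new levels are available. -/
theorem UndoAlong.step {s t : State V} (h : TrailInv s) {G : Finset (Chunk V)} {l : Lit V}
    {p q : List (Lit V)} (hs : s.trail = p ++ l :: q) (ht : UndoAlong s G p (l :: q) t) :
    UndoAlong s G (p ++ [l]) q (undoLit G t l) := by
  have hl : l ∈ s.trail := by simp [hs]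
  have hp : ∀ m ∈ p, m ∈ s.trail := fun m hm => by simp [hs, hm]
  have hd := h.nodup
  rw [hs] at hd
  have hlp : l ∉ p := fun hm => (List.nodup_append.1 hd).2.2 l hm l (by simp) rfl
  have hne : ∀ m ∈ s.trail, m ≠ l → m.1 ≠ l.1 := fun m hm hml e =>
    hml (h.eq_of_fst_eq hm hl e)
  have hpne : ∀ m ∈ p, m.1 ≠ l.1 := fun m hm => hne m (hp m hm) (fun e => hlp (e ▸ hm))
  have hcl : t.chunks l.1 = s.chunks l.1 := ht.chunks l hl fun h => absurd h hlp
  have hrl : t.reason l.1 = s.reason l.1 := ht.reason l hl fun h => absurd h hlp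
  have hT : t.Touches G l ↔ s.Touches G l := by simp only [Touches, hcl]
  have hpd : ∀ m ∈ p, ∀ d ∈ s.chunks m.1, d.1 ≠ l.1 := fun m hm d hdm => by
    obtain ⟨h1, -, h3⟩ := h.chunk m (hp m hm) d hdm
    refine hne d h1 fun e => ?_
    subst e
    rcases h3 with rfl | h3
    · exact hlp hm
    · rw [hs] at h3
      exact not_pair_sublist hd hm h3
  have hmemp : ∀ m, m ∈ p ++ [l] ↔ m ∈ p ∨ m = l := by simp
  unfold undoLit
  by_cases htl : s.Touches G l
  · rw [if_pos (hT.2 htl)]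
    refine ⟨?_, ht.clauses, ht.cross, ht.watch, ?_, ?_, ?_, ?_⟩
    · have : l ∉ p.filter (fun l => ¬ s.Touches G l) := fun hm => hlp (List.mem_filter.1 hm).1
      simp only [ht.trail, List.filter_append]
      rw [List.erase_append_right _ this]
      simp [htl]
    · intro m hm hmt
      have hml : m ≠ l := fun e => hmt (by simp [e]) (e ▸ htl)
      simp only [ne_eq, hne m hm hml, not_false_eq_true, Function.update_of_ne]
      exact ht.chunks m hm fun hmp => hmt (by simp [hmp])
    · intro m hm hmt
      have hml : m ≠ l := fun e => hmt (by simp [e]) (e ▸ htl)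
      simp only [ne_eq, hne m hm hml, not_false_eq_true, Function.update_of_ne]
      exact ht.reason m hm fun hmp => hmt (by simp [hmp])
    · intro m hm
      obtain ⟨h1, h2⟩ := ht.propagated m hm
      refine ⟨h1, fun hmp hmt => ?_⟩
      rcases (hmemp m).1 hmp with hmp | rfl
      · exact h2 hmp hmt
      · exact absurd htl hmt
    · intro m hm hmt
      rcases (hmemp m).1 hm with hm | rfl
      · simp only [chunkLevel, ne_eq, hpne m hm, not_false_eq_true, Function.update_of_ne]
        refine ⟨((ht.level m hm hmt).1).trans ?_, (ht.level m hm hmt).2⟩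
        unfold chunkLevel
        exact Finset.sup_congr rfl fun d hdm => by simp [hpd m hm d hdm]
      · exact absurd htl hmt
  · rw [if_neg (fun h => htl (hT.1 h))]
    refine ⟨?_, ht.clauses, ht.cross, ht.watch, ?_, ?_, ?_, ?_⟩
    · simp [ht.trail, List.filter_append, htl]
    · intro m hm hmt
      exact ht.chunks m hm fun hmp => hmt (by simp [hmp])
    · intro m hm hmt
      exact ht.reason m hm fun hmp => hmt (by simp [hmp])
    · intro m hm
      have hm' : m ∈ t.propagated ∧ ((t.cross l.1 ∩ G).Nonempty → m ≠ l) := by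
        dsimp only at hm
        split_ifs at hm with hc
        · exact ⟨Finset.mem_of_mem_erase hm, fun _ => Finset.ne_of_mem_erase hm⟩
        · exact ⟨hm, fun h => absurd h hc⟩
      obtain ⟨h1, h2⟩ := ht.propagated m hm'.1
      refine ⟨h1, fun hmp hmt => ?_⟩
      rcases (hmemp m).1 hmp with hmp | rfl
      · exact h2 hmp hmt
      · rw [← Finset.not_nonempty_iff_eq_empty, ← ht.cross]
        exact fun h => hm'.2 h rfl
    · intro m hm hmt
      rcases (hmemp m).1 hm with hm | rfl
      · simp only [chunkLevel, ne_eq, hpne m hm, not_false_eq_true, Function.update_of_ne]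
        refine ⟨((ht.level m hm hmt).1).trans ?_, (ht.level m hm hmt).2⟩
        unfold chunkLevel
        exact Finset.sup_congr rfl fun d hdm => by simp [hpd m hm d hdm]
      · simp only [Function.update_self]
        cases hR : s.reason m.1 with
        | none =>
          simp only [h.decision m hl hR, chunkLevel, Finset.sup_singleton, Function.update_self,
            true_and]
          simp only [updateLevel, hrl, hR]
          simp
        | some R =>
          obtain ⟨h1, h2, h3⟩ := h.implied m hl R hR
          have hprem : ∀ k ∈ R.erase m, neg k ∈ p := fun k hk => by
            have := h2 k (Finset.mem_of_mem_erase hk) (Finset.ne_of_mem_erase hk)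
            rw [hs] at this
            exact mem_of_pair_sublist hd this
          have hpt : ∀ k ∈ R.erase m, ¬ s.Touches G (neg k) := fun k hk hk' => by
            obtain ⟨d, hd1, hd2⟩ := touches_iff.1 hk'
            exact hmt (touches_iff.2 ⟨d, h3 ▸ mem_chunksOf.2 ⟨k, hk, hd1⟩, hd2⟩)
          simp only [updateLevel, hrl, hR]
          refine ⟨?_, ?_⟩
          · rw [h3]
            unfold levelOf chunkLevel chunksOf
            rw [Finset.sup_biUnion]
            refine Finset.sup_congr rfl fun k hk => ?_
            refine ((ht.level _ (hprem k hk) (hpt k hk)).1).trans ?_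
            unfold chunkLevel
            exact Finset.sup_congr rfl fun d hdm => by
              simp [hpd _ (hprem k hk) d hdm]
          · exact levelOf_ne_top fun k hk => (ht.level _ (hprem k hk) (hpt k hk)).2

theorem UndoAlong.foldl {s : State V} (h : TrailInv s) (G : Finset (Chunk V)) :
    ∀ (q p : List (Lit V)) (t : State V), s.trail = p ++ q → UndoAlong s G p q t →
      UndoAlong s G s.trail [] (q.foldl (undoLit G) t)
  | [], p, t, hs, ht => by simpa [hs] using ht
  | l :: q, p, t, hs, ht =>
    UndoAlong.foldl h G q (p ++ [l]) _ (by simp [hs]) (ht.step h hs)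

theorem TrailInv.undoAlong {s : State V} (h : TrailInv s) (G : Finset (Chunk V)) :
    UndoAlong s G s.trail [] (s.trail.foldl (undoLit G) s) := by
  refine UndoAlong.foldl h G s.trail [] s rfl ⟨rfl, rfl, rfl, rfl, ?_, ?_, ?_, ?_⟩ <;> simp

theorem TrailInv.mem_undo {s : State V} (h : TrailInv s) {G : Finset (Chunk V)} {l : Lit V} :
    l ∈ (s.undo G).trail ↔ l ∈ s.trail ∧ ¬ s.Touches G l := by
  have : (s.undo G).trail = _ := (h.undoAlong G).trail
  simp [this]

/-- Touching `G` is inherited from premises, so the premises of a survivor survive, and filtering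
keeps the order. -/
theorem TrailInv.undo {s : State V} (h : TrailInv s) (G : Finset (Chunk V)) :
    TrailInv (s.undo G) := by
  have hu := h.undoAlong G
  set t := s.trail.foldl (undoLit G) s with ht
  refine TrailInv.congr (s := t) ?_ rfl rfl rfl rfl
  have htr : t.trail = s.trail.filter (fun l => ¬ s.Touches G l) := by simpa using hu.trail
  have hmem : ∀ m, m ∈ t.trail ↔ m ∈ s.trail ∧ ¬ s.Touches G m := fun m => by simp [htr]
  have hc : ∀ m ∈ t.trail, t.chunks m.1 = s.chunks m.1 := fun m hm =>
    hu.chunks m ((hmem m).1 hm).1 fun _ => ((hmem m).1 hm).2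
  have hr : ∀ m ∈ t.trail, t.reason m.1 = s.reason m.1 := fun m hm =>
    hu.reason m ((hmem m).1 hm).1 fun _ => ((hmem m).1 hm).2
  have hpair : ∀ a b, a ∈ t.trail → b ∈ t.trail → [a, b].Sublist s.trail →
      [a, b].Sublist t.trail := fun a b ha hb hab => by
    have := hab.filter (fun l => ¬ s.Touches G l)
    rw [htr]
    simpa [((hmem a).1 ha).2, ((hmem b).1 hb).2] using this
  refine ⟨?_, ?_, ?_, ?_, ?_, ?_⟩
  · rw [htr]
    exact h.nodup.filter _
  · exact fun l hl hl' => h.consistent l ((hmem l).1 hl).1 ((hmem _).1 hl').1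
  · intro l hl R hR
    rw [hr l hl] at hR
    obtain ⟨h1, h2, h3⟩ := h.implied l ((hmem l).1 hl).1 R hR
    have hk : ∀ k ∈ R, k ≠ l → neg k ∈ t.trail := fun k hk hkl => by
      refine (hmem _).2 ⟨(h2 k hk hkl).subset (by simp), fun hkt => ?_⟩
      obtain ⟨d, hd1, hd2⟩ := touches_iff.1 hkt
      exact ((hmem l).1 hl).2 (touches_iff.2
        ⟨d, h3 ▸ mem_chunksOf.2 ⟨k, Finset.mem_erase.2 ⟨hkl, hk⟩, hd1⟩, hd2⟩)
    refine ⟨h1, fun k hk1 hk2 => hpair _ _ (hk k hk1 hk2) hl (h2 k hk1 hk2), ?_⟩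
    rw [hc l hl, h3]
    exact Finset.biUnion_congr rfl fun k hk' =>
      (hc (neg k) (hk k (Finset.mem_of_mem_erase hk') (Finset.ne_of_mem_erase hk'))).symm
  · intro l hl hR
    rw [hc l hl]
    exact h.decision l ((hmem l).1 hl).1 (hr l hl ▸ hR)
  · intro l hl d hd
    rw [hc l hl] at hd
    obtain ⟨h1, h2, h3⟩ := h.chunk l ((hmem l).1 hl).1 d hd
    -- A decision belongs to its own chunk only: were `d` undone, then `d ∈ G`, and `l` would be
    -- undone as well.
    have hdt : d ∈ t.trail := by
      refine (hmem d).2 ⟨h1, fun hdt => ?_⟩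
      obtain ⟨e, he1, he2⟩ := touches_iff.1 hdt
      rw [h.decision d h1 h2, Finset.mem_singleton] at he1
      subst he1
      exact ((hmem l).1 hl).2 (touches_iff.2 ⟨e, hd, he2⟩)
    exact ⟨hdt, hr d hdt ▸ h2, h3.imp_right (hpair d l hdt hl)⟩
  · intro l hl
    rw [hc l hl]
    exact hu.level l ((hmem l).1 hl).1 ((hmem l).1 hl).2

/-! ### Conflict analysis -/

/-- Here `p` is the part of the trail still to be traversed. A resolution step replaces a literal by
premises with the same chunks in total, so `D` stays within `K` and keeps a literal touching `G`;
since the complements of all such literals lie in `p`, the traversal must stop before `p` is used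
up. -/
theorem analyzeAlong_spec {F : CNF V} {s : State V} (h : TrailInv s)
    (hF : ∀ l ∈ s.trail, ∀ R, s.reason l.1 = some R → Derivable F R)
    {G K : Finset (Chunk V)} {d : Chunk V} (hK : G ∩ K = {d}) :
    ∀ (p q : List (Lit V)) (D : Clause V), s.trail = p.reverse ++ q → Derivable F D →
      (∀ m ∈ D, neg m ∈ s.trail) → s.chunksOf D ⊆ K → (∃ m ∈ D, s.Touches G m) →
      (∀ m ∈ D, s.Touches G m → neg m ∈ p) →
      ∃ D', s.analyzeAlong G p D = some D' ∧ Derivable F D' ∧ (∀ m ∈ D', neg m ∈ s.trail) ∧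
        s.chunksOf D' ⊆ K ∧ (D'.filter (s.Touches G)).card = 1
  | [], _, D, _, _, _, _, ⟨m, hm, hmt⟩, hp => by simpa using hp m hm hmt
  | l :: p, q, D, hs, hD, hfalse, hDK, hex, hp => by
    unfold analyzeAlong
    by_cases hcard : (D.filter (s.Touches G)).card = 1
    · rw [if_pos hcard]
      exact ⟨D, rfl, hD, hfalse, hDK, hcard⟩
    rw [if_neg hcard]
    have hs' : s.trail = p.reverse ++ l :: q := by simpa using hs
    have hd := h.nodup
    rw [hs'] at hd
    have hl : l ∈ s.trail := by simp [hs']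
    by_cases hc : neg l ∈ D ∧ s.Touches G l
    · rw [if_pos hc]
      cases hR : s.reason l.1 with
      | none =>
        -- A decision reached here would be `d` itself. As the count is neither zero nor one, a
        -- second literal touches `G`, hence lies in the chunk of `d`; its complement follows `d` on
        -- the trail, whereas `hp` places it before.
        exfalso
        have hch := h.decision l hl hR
        have hlG : l ∈ G := by
          obtain ⟨e, he1, he2⟩ := touches_iff.1 hc.2
          rw [hch, Finset.mem_singleton] at he1
          exact he1 ▸ he2
        have hmem : ∀ e, e ∈ G → e ∈ K → e = d := fun e h1 h2 =>
          Finset.mem_singleton.1 (hK ▸ Finset.mem_inter.2 ⟨h1, h2⟩)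
        have hld : l = d := hmem l hlG (hDK (mem_chunksOf.2 ⟨neg l, hc.1, by simp [hch]⟩))
        have hmem' : neg l ∈ D.filter (s.Touches G) := Finset.mem_filter.2 hc
        have h1 : 1 < (D.filter (s.Touches G)).card := by
          have := Finset.card_pos.2 ⟨_, hmem'⟩
          omega
        obtain ⟨m, hm, hml⟩ := Finset.exists_mem_ne h1 (neg l)
        obtain ⟨hmD, hmt⟩ := Finset.mem_filter.1 hm
        have hne : neg m ≠ l := fun e => hml (neg_eq_iff.1 e)
        have hmp : neg m ∈ p.reverse := by
          simpa [hne] using hp m hmD hmt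
        obtain ⟨e, he1, he2⟩ := touches_iff.1 hmt
        obtain rfl : e = l := (hmem e he2 (hDK (mem_chunksOf.2 ⟨m, hmD, he1⟩))).trans hld.symm
        rcases (h.chunk (neg m) (hfalse m hmD) e he1).2.2 with h3 | h3
        · exact hne h3.symm
        · rw [hs'] at h3
          exact not_pair_sublist hd hmp h3
      | some R =>
        obtain ⟨h1, h2, h3⟩ := h.implied l hl R hR
        have hpre : ∀ m ∈ R.erase l, neg m ∈ p.reverse := fun m hm => by
          have := h2 m (Finset.mem_of_mem_erase hm) (Finset.ne_of_mem_erase hm)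
          rw [hs'] at this
          exact mem_of_pair_sublist hd this
        have hres : ∀ m ∈ resolve l D R, (m ∈ D ∧ m ≠ neg l) ∨ m ∈ R.erase l := fun m hm => by
          rcases Finset.mem_union.1 hm with hm | hm
          · exact Or.inl ⟨Finset.mem_of_mem_erase hm, Finset.ne_of_mem_erase hm⟩
          · exact Or.inr hm
        refine analyzeAlong_spec h hF hK p (l :: q) _ hs' (hD.res (hF l hl R hR) hc.1 h1)
          ?_ ?_ ?_ ?_
        · intro m hm
          rcases hres m hm with hm | hm
          · exact hfalse m hm.1
          · rw [hs']
            exact List.mem_append_left _ (hpre m hm)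
        · intro e he
          obtain ⟨m, hm, hem⟩ := mem_chunksOf.1 he
          rcases hres m hm with hm | hm
          · exact hDK (mem_chunksOf.2 ⟨m, hm.1, hem⟩)
          · exact hDK (mem_chunksOf.2 ⟨neg l, hc.1, h3 ▸ mem_chunksOf.2 ⟨m, hm, hem⟩⟩)
        · obtain ⟨e, he1, he2⟩ := touches_iff.1 hc.2
          rw [h3] at he1
          obtain ⟨m, hm, hem⟩ := mem_chunksOf.1 he1
          exact ⟨m, Finset.mem_union_right _ hm, touches_iff.2 ⟨e, hem, he2⟩⟩
        · intro m hm hmt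
          rcases hres m hm with hm | hm
          · have hne : neg m ≠ l := fun e => hm.2 (neg_eq_iff.1 e)
            simpa [hne] using hp m hm.1 hmt
          · simpa using hpre m hm
    · rw [if_neg hc]
      refine analyzeAlong_spec h hF hK p (l :: q) D hs' hD hfalse hDK hex fun m hm hmt => ?_
      have hne : neg m ≠ l := fun e => hc (by
        obtain rfl : m = neg l := neg_eq_iff.1 e
        exact ⟨hm, hmt⟩)
      simpa [hne] using hp m hm hmt

theorem analyze_spec {F : CNF V} {s : State V} (h : TrailInv s)
    (hF : ∀ l ∈ s.trail, ∀ R, s.reason l.1 = some R → Derivable F R) {C : Clause V}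
    (hC : Derivable F C) (hfalse : ∀ m ∈ C, neg m ∈ s.trail) {G : Finset (Chunk V)}
    (hG : (G ∩ s.chunksOf C).card = 1) :
    ∃ D, s.analyze C G = some D ∧ Derivable F D ∧ (∀ m ∈ D, neg m ∈ s.trail) ∧
        s.chunksOf D ⊆ s.chunksOf C ∧ (D.filter (s.Touches G)).card = 1 := by
  obtain ⟨d, hd⟩ := Finset.card_eq_one.1 hG
  refine analyzeAlong_spec h hF hd s.trail.reverse [] C (by simp) hC hfalse subset_rfl ?_ ?_
  · have : d ∈ G ∩ s.chunksOf C := hd ▸ Finset.mem_singleton_self d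
    obtain ⟨h1, h2⟩ := Finset.mem_inter.1 this
    obtain ⟨m, hm, hdm⟩ := mem_chunksOf.1 h2
    exact ⟨m, hm, touches_iff.2 ⟨d, hdm, h1⟩⟩
  · exact fun m hm _ => by simpa using hfalse m hm

/-- A derivable clause that is falsified by literals in no chunk yields the empty clause. -/
theorem derivable_empty {F : CNF V} {s : State V} (h : TrailInv s)
    (hF : ∀ l ∈ s.trail, ∀ R, s.reason l.1 = some R → Derivable F R) :
    ∀ (p q : List (Lit V)) (D : Clause V), s.trail = p.reverse ++ q → Derivable F D →
      (∀ m ∈ D, neg m ∈ p) → s.chunksOf D = ∅ → Derivable F ∅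
  | [], _, D, _, hD, hp, _ => by
    obtain rfl : D = ∅ := Finset.eq_empty_of_forall_notMem fun m hm => by simpa using hp m hm
    exact hD
  | l :: p, q, D, hs, hD, hp, hDK => by
    have hs' : s.trail = p.reverse ++ l :: q := by simpa using hs
    have hd := h.nodup
    rw [hs'] at hd
    have hl : l ∈ s.trail := by simp [hs']
    by_cases hc : neg l ∈ D
    · have hlc : s.chunks l.1 = ∅ := Finset.subset_empty.1 fun e he =>
        hDK ▸ mem_chunksOf.2 ⟨neg l, hc, he⟩
      -- A decision has a chunk, so `l` must have a justification, whose premises again lie in no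
      -- chunk.
      cases hR : s.reason l.1 with
      | none => simp [h.decision l hl hR] at hlc
      | some R =>
        obtain ⟨h1, h2, h3⟩ := h.implied l hl R hR
        refine derivable_empty h hF p (l :: q) _ hs' (hD.res (hF l hl R hR) hc h1) ?_ ?_
        · intro m hm
          rcases Finset.mem_union.1 hm with hm | hm
          · have hne : neg m ≠ l := fun e => Finset.ne_of_mem_erase hm (neg_eq_iff.1 e)
            simpa [hne] using hp m (Finset.mem_of_mem_erase hm)
          · have := h2 m (Finset.mem_of_mem_erase hm) (Finset.ne_of_mem_erase hm)
            rw [hs'] at this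
            simpa using mem_of_pair_sublist hd this
        · refine Finset.subset_empty.1 fun e he => ?_
          obtain ⟨m, hm, hem⟩ := mem_chunksOf.1 he
          rcases Finset.mem_union.1 hm with hm | hm
          · exact hDK ▸ mem_chunksOf.2 ⟨m, Finset.mem_of_mem_erase hm, hem⟩
          · exact hlc ▸ h3 ▸ mem_chunksOf.2 ⟨m, hm, hem⟩
    · refine derivable_empty h hF p (l :: q) D hs' hD (fun m hm => ?_) hDK
      have hne : neg m ≠ l := fun e => hc (neg_eq_iff.1 e ▸ hm)
      simpa [hne] using hp m hm

end GraphBT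

namespace GraphBT
variable {V : Type*} [DecidableEq V]
open State

/-! ### Invariants of the solver -/

theorem pair_eq {α : Type*} [DecidableEq α] {a b x y : α} (h : ({a, b} : Finset α) = {x, y}) :
    (a = x ∧ b = y) ∨ (a = y ∧ b = x) := by
  have := congrArg (fun s : Finset α => (s : Set α)) h
  simp only [Finset.coe_insert, Finset.coe_singleton] at this
  exact Set.pair_eq_pair_iff.1 this

/-- Invariants that hold at all program points. -/
structure Base (F : CNF V) (s : State V) : Prop extends TrailInv s where
  subset : ∀ l ∈ s.propagated, l ∈ s.trail
  input : F ⊆ s.clauses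
  derivable : ∀ C ∈ s.clauses, Derivable F C
  reason : ∀ l ∈ s.trail, ∀ R, s.reason l.1 = some R → Derivable F R
  watched : ∀ C ∈ s.clauses, 2 ≤ C.card → ∃ a ∈ C, ∃ b ∈ C, a ≠ b ∧ s.watch C = {a, b}
  other : ∀ C ∈ s.clauses, 2 ≤ C.card → ∀ a b, s.watch C = {a, b} → neg a ∈ s.propagated →
    b ∈ s.trail ∧ s.chunks b.1 ⊆ s.cross a.1

/-- Every clause of length at most one is satisfied by a literal that belongs to no chunk. -/
def Small (s : State V) : Prop :=
  ∀ C ∈ s.clauses, C.card ≤ 1 → ∃ l ∈ C, l ∈ s.trail ∧ s.chunks l.1 = ∅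

/-- Invariants of the propagation of `l`, where the clauses in `P` are still to be inspected. -/
structure VisitInv (s : State V) (l : Lit V) (P : Finset (Clause V)) : Prop where
  mem : l ∈ s.trail
  notMem : l ∉ s.propagated
  todo : P ⊆ s.watchList (neg l)
  done : ∀ C ∈ s.clauses, 2 ≤ C.card → C ∉ P → ∀ b, s.watch C = {neg l, b} →
    b ∈ s.trail ∧ s.chunks b.1 ⊆ s.cross l.1

/-- Invariants that depend on the program point. -/
def ControlInv [Fintype V] (F : CNF V) (s : State V) : Control V → Prop
  | .loop => Small s
  | .visit l P => Small s ∧ VisitInv s l P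
  | .conflict C => C ∈ s.clauses ∧ (∀ m ∈ C, neg m ∈ s.trail) ∧ (Small s ∨ s.chunksOf C = ∅)
  | .sat => Small s ∧ s.queue = [] ∧ s.trail.length = Fintype.card V
  | .unsat => Derivable F ∅

structure Inv [Fintype V] (F : CNF V) (s : State V) : Prop extends Base F s where
  control : ControlInv F s s.control

variable {F : CNF V} {s : State V}

/-! ### Preservation of the basic invariants -/

namespace Base

theorem goto (h : Base F s) (k : Control V) : Base F (s.goto k) :=
  { h with toTrailInv := h.toTrailInv.congr rfl rfl rfl rfl }

theorem watch_mem (h : Base F s) {C : Clause V} (hC : C ∈ s.clauses) (hc : 2 ≤ C.card)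
    {a b : Lit V} (hw : s.watch C = {a, b}) : a ∈ C ∧ b ∈ C ∧ a ≠ b := by
  obtain ⟨x, hx, y, hy, hxy, hw'⟩ := h.watched C hC hc
  rcases pair_eq (hw.symm.trans hw') with ⟨rfl, rfl⟩ | ⟨rfl, rfl⟩
  · exact ⟨hx, hy, hxy⟩
  · exact ⟨hy, hx, hxy.symm⟩

theorem addCross (h : Base F s) (r c : Lit V) : Base F (s.addCross r c) :=
  { h with
    toTrailInv := h.toTrailInv.congr rfl rfl rfl rfl
    other := fun C hC hc a b hw ha => by
      obtain ⟨h1, h2⟩ := h.other C hC hc a b hw ha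
      refine ⟨h1, h2.trans ?_⟩
      by_cases e : a.1 = r.1
      · simp only [State.addCross, e, Function.update_self]
        exact Finset.subset_union_left
      · simp [State.addCross, e] }

theorem addClause (h : Base F s) {D : Clause V} (hD : Derivable F D) (hc : D.card < 2) :
    Base F (s.addClause D) := by
  have hmem : ∀ C ∈ (s.addClause D).clauses, 2 ≤ C.card → C ∈ s.clauses := fun C hC hc' => by
    rcases Finset.mem_insert.1 hC with rfl | hC
    · omega
    · exact hC
  exact { h with
    toTrailInv := h.toTrailInv.congr rfl rfl rfl rfl
    input := h.input.trans (Finset.subset_insert _ _)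
    derivable := fun C hC => by
      rcases Finset.mem_insert.1 hC with rfl | hC
      · exact hD
      · exact h.derivable C hC
    watched := fun C hC hc' => h.watched C (hmem C hC hc') hc'
    other := fun C hC hc' => h.other C (hmem C hC hc') hc' }

/-- If `D` is already present, the insertion changes nothing, so this also covers rewatching an old
clause. The hypotheses are the watch invariant for `D`, read from either watch; from `b` it holds
vacuously. -/
theorem addWatched (h : Base F s) {D : Clause V} (hD : Derivable F D) {a b : Lit V}
    (ha : a ∈ D) (hb : b ∈ D) (hab : a ≠ b)
    (h1 : neg a ∈ s.propagated → b ∈ s.trail ∧ s.chunks b.1 ⊆ s.cross a.1)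
    (h2 : neg b ∉ s.propagated) : Base F ((s.addClause D).setWatch D a b) := by
  have hmem : ∀ C ∈ insert D s.clauses, C ≠ D → C ∈ s.clauses := fun C hC hne =>
    (Finset.mem_insert.1 hC).resolve_left hne
  exact { h with
    toTrailInv := h.toTrailInv.congr rfl rfl rfl rfl
    input := h.input.trans (Finset.subset_insert _ _)
    derivable := fun C hC => by
      rcases Finset.mem_insert.1 hC with rfl | hC
      · exact hD
      · exact h.derivable C hC
    watched := fun C hC hc => by
      by_cases e : C = D
      · subst e
        exact ⟨a, ha, b, hb, hab, by simp [setWatch]⟩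
      · obtain ⟨x, hx, y, hy, hxy, hw⟩ := h.watched C (hmem C hC e) hc
        exact ⟨x, hx, y, hy, hxy, by simp [setWatch, e, State.addClause, hw]⟩
    other := fun C hC hc x y hw hx => by
      by_cases e : C = D
      · subst e
        simp only [setWatch, Function.update_self] at hw
        rcases pair_eq hw with ⟨rfl, rfl⟩ | ⟨rfl, rfl⟩
        · exact h1 hx
        · exact absurd hx h2
      · exact h.other C (hmem C hC e) hc x y
          (by simpa [setWatch, e, State.addClause] using hw) hx }

theorem setWatch (h : Base F s) {C : Clause V} (hC : C ∈ s.clauses) {a b : Lit V}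
    (ha : a ∈ C) (hb : b ∈ C) (hab : a ≠ b)
    (h1 : neg a ∈ s.propagated → b ∈ s.trail ∧ s.chunks b.1 ⊆ s.cross a.1)
    (h2 : neg b ∉ s.propagated) : Base F (s.setWatch C a b) := by
  have := h.addWatched (h.derivable C hC) ha hb hab h1 h2
  have e : s.addClause C = s := by
    simp [State.addClause, Finset.insert_eq_of_mem hC]
  rwa [e] at this

theorem imply (h : Base F s) {l : Lit V} {C : Clause V} (hl : s.Unassigned l) (hlC : l ∈ C)
    (hC : ∀ m ∈ C, m ≠ l → neg m ∈ s.trail) (hD : Derivable F C) : Base F (s.imply l C) :=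
  { h with
    toTrailInv := h.toTrailInv.imply hl hlC hC
    subset := fun m hm => List.mem_append_left _ (h.subset m hm)
    reason := fun m hm R hR => by
      by_cases e : m.1 = l.1
      · obtain rfl : C = R := by simpa [State.imply, e] using hR
        exact hD
      · have hm' : m ∈ s.trail := by
          rcases List.mem_append.1 hm with hm | hm
          · exact hm
          · exact absurd (by rw [List.mem_singleton.1 hm]) e
        exact h.reason m hm' R (by simpa [State.imply, e] using hR)
    other := fun D hD' hc a b hw ha => by
      obtain ⟨h1, h2⟩ := h.other D hD' hc a b hw ha
      refine ⟨List.mem_append_left _ h1, ?_⟩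
      simpa [State.imply, hl.fst_ne h1] using h2 }

theorem decide (h : Base F s) {l : Lit V} (hl : s.Unassigned l) : Base F (s.decide l) :=
  { h with
    toTrailInv := h.toTrailInv.decide hl
    subset := fun m hm => List.mem_append_left _ (h.subset m hm)
    reason := fun m hm R hR => by
      by_cases e : m.1 = l.1
      · simp [State.decide, e] at hR
      · have hm' : m ∈ s.trail := by
          rcases List.mem_append.1 hm with hm | hm
          · exact hm
          · exact absurd (by rw [List.mem_singleton.1 hm]) e
        exact h.reason m hm' R (by simpa [State.decide, e] using hR)
    other := fun D hD' hc a b hw ha => by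
      obtain ⟨h1, h2⟩ := h.other D hD' hc a b hw ha
      refine ⟨List.mem_append_left _ h1, ?_⟩
      simpa [State.decide, hl.fst_ne h1] using h2 }

theorem undo_clauses (h : Base F s) (G : Finset (Chunk V)) :
    (s.undo G).clauses = s.clauses := (h.undoAlong G).clauses

theorem undo_chunks (h : Base F s) {G : Finset (Chunk V)} {m : Lit V}
    (hm : m ∈ (s.undo G).trail) : (s.undo G).chunks m.1 = s.chunks m.1 :=
  (h.undoAlong G).chunks m (h.mem_undo.1 hm).1 fun _ => (h.mem_undo.1 hm).2

theorem undo_reason (h : Base F s) {G : Finset (Chunk V)} {m : Lit V}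
    (hm : m ∈ (s.undo G).trail) : (s.undo G).reason m.1 = s.reason m.1 :=
  (h.undoAlong G).reason m (h.mem_undo.1 hm).1 fun _ => (h.mem_undo.1 hm).2

/-- This is the purpose of cross-chunks: if `neg a` stays propagated, the cross-chunks of `a` avoid
`G`, hence so do the chunks of the other watch `b`, which therefore stays true. -/
theorem undo (h : Base F s) (G : Finset (Chunk V)) : Base F (s.undo G) := by
  have hu := h.undoAlong G
  have hwatch : (s.undo G).watch = s.watch := hu.watch
  have hcross : (s.undo G).cross = s.cross := hu.cross
  have hprop : ∀ m ∈ (s.undo G).propagated,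
      m ∈ s.propagated ∧ s.cross m.1 ∩ G = ∅ ∧ m ∈ (s.undo G).trail := fun m hm => by
    obtain ⟨h1, h2⟩ := Finset.mem_inter.1 hm
    have h2 : m ∈ (s.undo G).trail := List.mem_toFinset.1 h2
    obtain ⟨h3, h4⟩ := hu.propagated m h1
    exact ⟨h3, h4 (h.subset m h3) (h.mem_undo.1 h2).2, h2⟩
  refine ⟨h.toTrailInv.undo G, fun m hm => (hprop m hm).2.2, ?_, ?_, ?_, ?_, ?_⟩
  · rw [h.undo_clauses]
    exact h.input
  · rw [h.undo_clauses]
    exact h.derivable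
  · intro m hm R hR
    rw [h.undo_reason hm] at hR
    exact h.reason m (h.mem_undo.1 hm).1 R hR
  · rw [h.undo_clauses, hwatch]
    exact h.watched
  · rw [h.undo_clauses, hwatch, hcross]
    intro C hC hc a b hw ha
    obtain ⟨h1, h2, -⟩ := hprop _ ha
    obtain ⟨h3, h4⟩ := h.other C hC hc a b hw h1
    have hb : b ∈ (s.undo G).trail := by
      refine h.mem_undo.2 ⟨h3, fun hbt => ?_⟩
      obtain ⟨d, hd1, hd2⟩ := touches_iff.1 hbt
      have : d ∈ s.cross (neg a).1 ∩ G := Finset.mem_inter.2 ⟨h4 hd1, hd2⟩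
      rw [h2] at this
      exact absurd this (Finset.notMem_empty d)
    exact ⟨hb, h.undo_chunks hb ▸ h4⟩

/-- Neither `l` nor `neg l` is propagated, so the watch invariant does not refer to the cross-chunks
of this variable. -/
theorem start (h : Base F s) {l : Lit V} (hl : l ∈ s.trail) (hl' : l ∉ s.propagated)
    (S : Finset (Chunk V)) : Base F { s with cross := Function.update s.cross l.1 S } :=
  { h with
    toTrailInv := h.toTrailInv.congr rfl rfl rfl rfl
    other := fun C hC hc a b hw ha => by
      have e : a.1 ≠ l.1 := fun e => by
        rcases eq_or_eq_neg e with rfl | rfl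
        · exact h.consistent a hl (h.subset _ ha)
        · exact hl' (by simpa using ha)
      simpa [e] using h.other C hC hc a b hw ha }

theorem finish (h : Base F s) {l : Lit V} (hv : VisitInv s l ∅) :
    Base F { s with propagated := insert l s.propagated } :=
  { h with
    toTrailInv := h.toTrailInv.congr rfl rfl rfl rfl
    subset := fun m hm => by
      rcases Finset.mem_insert.1 hm with rfl | hm
      · exact hv.mem
      · exact h.subset m hm
    other := fun C hC hc a b hw ha => by
      rcases Finset.mem_insert.1 ha with ha | ha
      · obtain rfl : a = neg l := neg_eq_iff.1 ha
        exact hv.done C hC hc (by simp) b hw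
      · exact h.other C hC hc a b hw ha }

end Base

/-! ### Preservation of the other invariants -/

namespace Small

theorem imply (h : Small s) {l : Lit V} {C : Clause V} (hl : s.Unassigned l) :
    Small (s.imply l C) := fun D hD hc => by
  obtain ⟨m, hm, h1, h2⟩ := h D hD hc
  exact ⟨m, hm, List.mem_append_left _ h1, by simpa [State.imply, hl.fst_ne h1] using h2⟩

theorem decide (h : Small s) {l : Lit V} (hl : s.Unassigned l) :
    Small (s.decide l) := fun D hD hc => by
  obtain ⟨m, hm, h1, h2⟩ := h D hD hc
  exact ⟨m, hm, List.mem_append_left _ h1, by simpa [State.decide, hl.fst_ne h1] using h2⟩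

theorem undo (h : Small s) (hs : Base F s) (G : Finset (Chunk V)) : Small (s.undo G) := by
  intro D hD hc
  rw [hs.undo_clauses] at hD
  obtain ⟨m, hm, h1, h2⟩ := h D hD hc
  have hmt : m ∈ (s.undo G).trail := hs.mem_undo.2 ⟨h1, by simp [touches_iff, h2]⟩
  exact ⟨m, hm, hmt, by rw [hs.undo_chunks hmt, h2]⟩

end Small

namespace VisitInv
variable {l : Lit V} {P : Finset (Clause V)}

theorem addCross (h : VisitInv s l P) (r c : Lit V) : VisitInv (s.addCross r c) l P :=
  { h with
    done := fun C hC hc hP b hw => by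
      obtain ⟨h1, h2⟩ := h.done C hC hc hP b hw
      refine ⟨h1, h2.trans ?_⟩
      by_cases e : l.1 = r.1
      · simp only [State.addCross, e, Function.update_self]
        exact Finset.subset_union_left
      · simp [State.addCross, e] }

theorem imply (h : VisitInv s l P) {c : Lit V} {C : Clause V} (hc : s.Unassigned c) :
    VisitInv (s.imply c C) l P :=
  { h with
    mem := List.mem_append_left _ h.mem
    done := fun D hD hcard hP b hw => by
      obtain ⟨h1, h2⟩ := h.done D hD hcard hP b hw
      refine ⟨List.mem_append_left _ h1, ?_⟩
      simpa [State.imply, hc.fst_ne h1] using h2 }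

/-- Once inspected, `C` must satisfy the condition `done`, which is a demand only if the old watch
`neg l` is kept as `r`. -/
theorem setWatch (h : VisitInv s l P) {C : Clause V} {r c : Lit V} (hc : c ≠ neg l)
    (hr : r = neg l → c ∈ s.trail ∧ s.chunks c.1 ⊆ s.cross l.1) :
    VisitInv (s.setWatch C r c) l (P.erase C) :=
  { h with
    todo := fun D hD => by
      obtain ⟨h1, h2, h3⟩ := Finset.mem_filter.1 (h.todo (Finset.mem_of_mem_erase hD))
      have hne := Finset.ne_of_mem_erase hD
      exact Finset.mem_filter.2 ⟨h1, h2, by simpa [State.setWatch, hne] using h3⟩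
    done := fun D hD hcard hP b hw => by
      by_cases e : D = C
      · subst e
        simp only [State.setWatch, Function.update_self] at hw
        rcases pair_eq hw with ⟨h1, rfl⟩ | ⟨-, h2⟩
        · exact hr h1
        · exact absurd h2 hc
      · exact h.done D hD hcard (fun hDP => hP (Finset.mem_erase.2 ⟨e, hDP⟩)) b
          (by simpa [State.setWatch, e] using hw) }

theorem skip (h : VisitInv s l P) {C : Clause V} {c : Lit V} (hw : s.watch C = {neg l, c})
    (hc : c ∈ s.trail ∧ s.chunks c.1 ⊆ s.cross l.1) : VisitInv s l (P.erase C) :=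
  { h with
    todo := (Finset.erase_subset _ _).trans h.todo
    done := fun D hD hcard hP b hwD => by
      by_cases e : D = C
      · subst e
        rcases pair_eq (hw.symm.trans hwD) with ⟨-, rfl⟩ | ⟨rfl, rfl⟩
        · exact hc
        · exact hc
      · exact h.done D hD hcard (fun hDP => hP (Finset.mem_erase.2 ⟨e, hDP⟩)) b hwD }

/-- The facts about the inspected clause. -/
theorem inspect (h : VisitInv s l P) (hs : Base F s) {C : Clause V} (hC : C ∈ P) {c : Lit V}
    (hw : s.watch C = {neg l, c}) :
    C ∈ s.clauses ∧ 2 ≤ C.card ∧ neg l ∈ C ∧ c ∈ C ∧ c ≠ neg l ∧ neg c ∉ s.propagated := by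
  obtain ⟨h1, h2, -⟩ := Finset.mem_filter.1 (h.todo hC)
  obtain ⟨h3, h4, h5⟩ := hs.watch_mem h1 h2 hw
  -- Were `neg c` propagated, the watch invariant read from `c` would make the false literal `neg l`
  -- true.
  refine ⟨h1, h2, h3, h4, h5.symm, fun hp => ?_⟩
  exact hs.consistent l h.mem (hs.other C h1 h2 c (neg l) (by rw [hw, Finset.pair_comm]) hp).1

end VisitInv

/-- All literals of the inspected clause except possibly `c` are false, if no better watched
literal has been found. -/
theorem State.IsReplacement.false_of_false {C : Clause V} {c r : Lit V}
    (h : s.IsReplacement C c r) (hr : neg r ∈ s.trail) : ∀ m ∈ C, m ≠ c → neg m ∈ s.trail :=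
  fun m hm hmc => by
    by_contra hcon
    exact h.2.2.1 ⟨m, hm, hmc, hcon⟩ hr

theorem mem_queue {l : Lit V} : l ∈ s.queue ↔ l ∈ s.trail ∧ l ∉ s.propagated := by
  simp [queue]

/-- The facts about a conflict that does not end the execution. -/
theorem conflict_spec (h : Base F s) {C : Clause V} (hC : C ∈ s.clauses)
    (hfalse : ∀ m ∈ C, neg m ∈ s.trail) {G : Finset (Chunk V)}
    (hG : (G ∩ s.chunksOf C).card = 1) :
    ∃ D, s.analyze C G = some D ∧ Derivable F D ∧ (∀ m ∈ D, neg m ∈ s.trail) ∧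
      s.chunksOf D ⊆ s.chunksOf C ∧ ∃ c ∈ D, (s.undo G).Unassigned c ∧
      ∀ m ∈ D, s.Touches G m ↔ m = c := by
  obtain ⟨D, h1, h2, h3, h4, h5⟩ := analyze_spec h.toTrailInv h.reason (h.derivable C hC) hfalse hG
  obtain ⟨c, hc⟩ := Finset.card_eq_one.1 h5
  have hiff : ∀ m ∈ D, s.Touches G m ↔ m = c := fun m hm => by
    have := Finset.ext_iff.1 hc m
    simpa [hm] using this
  have hcD : c ∈ D := (Finset.mem_filter.1 (hc ▸ Finset.mem_singleton_self c :
    c ∈ D.filter (s.Touches G))).1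
  refine ⟨D, h1, h2, h3, h4, c, hcD, ⟨fun hm => ?_, fun hm => ?_⟩, hiff⟩
  · exact (h.mem_undo.1 hm).2 ((hiff c hcD).2 rfl)
  · exact (h.mem_undo.1 hm).2 ((hiff c hcD).2 rfl)

/-- The state after backtracking and asserting the learned clause. -/
theorem Base.undo_imply (h : Base F s) {C D : Clause V} {G : Finset (Chunk V)} {c : Lit V}
    (hC : C ∈ s.clauses) (hfalse : ∀ m ∈ C, neg m ∈ s.trail)
    (hG : (G ∩ s.chunksOf C).card = 1) (hD : s.analyze C G = some D)
    (huniq : ∀ m ∈ D, (s.undo G).Unassigned m ↔ m = c) (hc : c ∈ D) :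
    Base F ((s.undo G).imply c D) ∧ Derivable F D ∧ (s.undo G).Unassigned c := by
  obtain ⟨D', h1, h2, h3, -, -⟩ := conflict_spec h hC hfalse hG
  obtain rfl : D = D' := Option.some_injective _ (hD.symm.trans h1)
  have hun := (huniq c hc).2 rfl
  refine ⟨(h.undo G).imply hun hc (fun m hm hmc => ?_) h2, h2, hun⟩
  -- All of `D` was false before backtracking, so no literal of `D` is true now; one that is not
  -- false would be unassigned, hence equal to `c`.
  by_contra hcon
  refine hmc ((huniq m hm).1 ⟨fun hm' => ?_, hcon⟩)
  exact h.consistent m (h.mem_undo.1 hm').1 (h3 m hm)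

variable [Fintype V]

theorem Inv.step {ζ : Lit V → ℝ} {s' : State V} (h : Inv F s) (hstep : Step ζ s s') :
    Inv F s' := by
  have hb := h.toBase
  have hctl := h.control
  cases hstep with
  | sat hk hq hn =>
    rw [hk] at hctl
    exact ⟨hb.goto _, hctl, hq, hn⟩
  | decide hk hq hn hl =>
    refine ⟨hb.decide hl, ?_⟩
    rw [hk] at hctl
    simp only [State.decide, hk]
    exact hctl.decide hl
  | @start l q hk hq =>
    have hl : l ∈ s.queue := by simp [hq]
    obtain ⟨h1, h2⟩ := mem_queue.1 hl
    rw [hk] at hctl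
    refine ⟨(hb.start h1 h2 _).goto _, hctl, h1, h2, fun _ h => h, fun C hC hc hP b hw => ?_⟩
    exfalso
    refine hP (Finset.mem_filter.2 ⟨hC, hc, ?_⟩)
    have hw : s.watch C = {neg l, b} := hw
    simp [hw]
  | finish hk =>
    rw [hk] at hctl
    exact ⟨(hb.finish hctl.2).goto _, hctl.1⟩
  | skip hk hC hw hc =>
    rw [hk] at hctl
    obtain ⟨h1, h2, h3, h4⟩ := hctl.2.skip (C := _) hw hc
    exact ⟨hb.goto _, hctl.1, h1, h2, h3, h4⟩
  | @replace l c r P C hk hC hw hskip hr hrt =>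
    rw [hk] at hctl
    obtain ⟨h1, h2, h3, h4, h5, h6⟩ := hctl.2.inspect hb hC hw
    have hrl : r ≠ neg l := fun e => hrt (by simpa [e] using hctl.2.mem)
    obtain ⟨g1, g2, g3, g4⟩ := hctl.2.setWatch (C := C) (r := r) h5 fun e => absurd e hrl
    refine ⟨(hb.setWatch h1 hr.1 h4 hr.2.1 (fun hp => absurd (hb.subset _ hp) hrt) h6).goto _,
      hctl.1, g1, g2, g3, g4⟩
  | @conflict l c r P C hk hC hw hskip hr hrt hct =>
    rw [hk] at hctl
    obtain ⟨h1, h2, h3, h4, h5, h6⟩ := hctl.2.inspect hb hC hw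
    -- Neither watch is true here, so the invariant requires that neither complement be propagated:
    -- the last clause of `IsReplacement` ensures this for `r`, `inspect` for `c`.
    refine ⟨(hb.setWatch h1 hr.1 h4 hr.2.1 (fun hp => absurd hp (hr.2.2.2 hct)) h6).goto _,
      h1, fun m hm => ?_, Or.inl hctl.1⟩
    by_cases e : m = c
    · exact e ▸ hct
    · exact hr.false_of_false hrt m hm e
  | @missed l c r P C hk hC hw hskip hr hrt hct =>
    rw [hk] at hctl
    obtain ⟨h1, h2, h3, h4, h5, h6⟩ := hctl.2.inspect hb hC hw
    have hsub : s.chunks c.1 ⊆ (s.addCross r c).cross r.1 := by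
      simp [State.addCross, Finset.subset_union_right]
    -- The two updates concern different fields and commute definitionally; adding the cross-chunks
    -- first supplies the inclusion that the new watches need.
    have hB : Base F ((s.addCross r c).setWatch C r c) :=
      (hb.addCross r c).setWatch h1 hr.1 h4 hr.2.1 (fun _ => ⟨hct, hsub⟩) h6
    obtain ⟨g1, g2, g3, g4⟩ := (hctl.2.addCross r c).setWatch (C := C) (r := r) h5
      fun e => ⟨hct, by subst e; exact hsub⟩
    exact ⟨hB.goto _, hctl.1, g1, g2, g3, g4⟩
  | @imply l c r P C hk hC hw hskip hr hrt hct =>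
    rw [hk] at hctl
    obtain ⟨h1, h2, h3, h4, h5, h6⟩ := hctl.2.inspect hb hC hw
    have hmem : c ∈ (s.imply c C).trail := List.mem_append_right _ (by simp)
    have hsub : (s.imply c C).chunks c.1 ⊆ ((s.imply c C).addCross r c).cross r.1 := by
      simp [State.addCross, Finset.subset_union_right]
    have hI := hb.imply hct h4 (hr.false_of_false hrt) (hb.derivable C h1)
    have hB : Base F (((s.imply c C).addCross r c).setWatch C r c) :=
      (hI.addCross r c).setWatch h1 hr.1 h4 hr.2.1 (fun _ => ⟨hmem, hsub⟩) h6
    obtain ⟨g1, g2, g3, g4⟩ := ((hctl.2.imply (C := C) hct).addCross r c).setWatch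
      (C := C) (r := r) h5 fun e => ⟨hmem, by subst e; exact hsub⟩
    exact ⟨hB.goto _, hctl.1.imply hct, g1, g2, g3, g4⟩
  | @unsat C hk hC =>
    rw [hk] at hctl
    refine ⟨hb.goto _, ?_⟩
    exact derivable_empty hb.toTrailInv hb.reason s.trail.reverse [] C (by simp)
      (hb.derivable C hctl.1) (fun m hm => by simpa using hctl.2.1 m hm) hC
  | @learnUnit C D G c hk hC hG hD huniq hc hcard =>
    rw [hk] at hctl
    obtain ⟨h1, h2, h3⟩ := hctl
    obtain ⟨hB, hder, hun⟩ := hb.undo_imply h1 h2 hG.1.2.1 hD huniq hc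
    have hsmall := ((h3.resolve_right hC).undo hb G).imply (C := D) hun
    refine ⟨(hB.addClause hder hcard).goto _, fun E hE hE' => ?_⟩
    rcases Finset.mem_insert.1 hE with rfl | hE
    · refine ⟨c, hc, List.mem_append_right _ (by simp), ?_⟩
      -- A learned unit clause has no premises, so its literal belongs to no chunk.
      obtain rfl : {c} = E := Finset.eq_of_subset_of_card_le
        (Finset.singleton_subset_iff.2 hc) (by simpa using hE')
      simp [State.goto, State.addClause, State.imply, chunksOf]
    · exact hsmall E hE hE'
  | @learn C D G c₁ c hk hC hG hD huniq hc hcard hc₁ hne =>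
    rw [hk] at hctl
    obtain ⟨h1, h2, h3⟩ := hctl
    obtain ⟨hB, hder, hun⟩ := hb.undo_imply h1 h2 hG.1.2.1 hD huniq hc
    have hsmall := ((h3.resolve_right hC).undo hb G).imply (C := D) hun
    set t := (s.undo G).imply c D
    have hct : c ∈ t.trail := List.mem_append_right _ (by simp)
    have hB' : Base F (((t.addCross c₁ c).addClause D).setWatch D c₁ c) :=
      (hB.addCross c₁ c).addWatched hder hc₁ hc hne
        (fun _ => ⟨hct, by simp [State.addCross, Finset.subset_union_right]⟩)
        (fun hp => hun.2 ((hb.undo G).subset _ hp))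
    refine ⟨hB'.goto _, fun E hE hE' => ?_⟩
    rcases Finset.mem_insert.1 hE with rfl | hE
    · omega
    · exact hsmall E hE hE'

theorem Inv.initial (h : Initial F s) : Inv F s := by
  have hpair : ∀ l ∈ s.trail, ∀ R, s.reason l.1 = some R → R = {l} := fun l hl R hR =>
    Option.some_injective _ (hR.symm.trans (h.assigned l hl).1)
  refine ⟨⟨⟨h.nodup, fun l hl => (h.units l hl).2, ?_, ?_, ?_, ?_⟩, ?_, ?_, ?_, ?_, ?_, ?_⟩, ?_⟩
  · intro l hl R hR
    obtain rfl := hpair l hl R hR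
    simp [h.chunks, chunksOf]
  · intro l hl hR
    simp [(h.assigned l hl).1] at hR
  · intro l hl d hd
    simp [h.chunks] at hd
  · intro l hl
    simp [(h.assigned l hl).2, h.chunks, chunkLevel]
  · simp [h.propagated]
  · rw [h.clauses]
  · rw [h.clauses]
    exact fun C hC => .ax hC
  · intro l hl R hR
    rw [hpair l hl R hR]
    exact .ax (h.units l hl).1
  · rw [h.clauses]
    exact h.watch
  · simp [h.propagated]
  · rcases h.control with ⟨hk, hc⟩ | ⟨C, hC, -, hf, hk⟩
    · rw [hk]
      intro C hC hcard
      obtain ⟨l, hl, hlt⟩ := hc C (h.clauses ▸ hC) hcard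
      exact ⟨l, hl, hlt, h.chunks _⟩
    · rw [hk]
      -- `Small` may fail at an initial conflict, but there are no chunks yet, so the second
      -- alternative holds.
      exact ⟨h.clauses.symm ▸ hC, hf, Or.inr <| Finset.eq_empty_of_forall_notMem fun d hd => by
        simp [mem_chunksOf, h.chunks] at hd⟩

theorem Inv.of_reachable {ζ : Lit V → ℝ} (h : Reachable ζ F s) : Inv F s := by
  obtain ⟨s₀, h0, hr⟩ := h
  induction hr with
  | refl => exact Inv.initial h0
  | tail _ hst ih => exact ih.step hst

end GraphBT

namespace GraphBT
variable {V : Type*} [DecidableEq V] {F : CNF V} {s : State V}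
open State

/-! ### Soundness -/

theorem Derivable.satisfies {a : V → Bool} (ha : Satisfies a F) {C : Clause V}
    (h : Derivable F C) : ∃ l ∈ C, a l.1 = l.2 := by
  induction h with
  | ax hC => exact ha _ hC
  | @res C D l _ _ _ _ ih₁ ih₂ =>
    obtain ⟨m, hm, hma⟩ := ih₁
    obtain ⟨k, hk, hka⟩ := ih₂
    by_cases hml : m = neg l
    · have hkl : k ≠ l := fun e => by
        subst hml e
        rw [neg_fst, hka] at hma
        simp [neg] at hma
      exact ⟨k, Finset.mem_union_right _ (Finset.mem_erase.2 ⟨hkl, hk⟩), hka⟩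
    · exact ⟨m, Finset.mem_union_left _ (Finset.mem_erase.2 ⟨hml, hm⟩), hma⟩

theorem Derivable.not_satisfiable (h : Derivable F ∅) : ¬ Satisfiable F := fun ⟨_, ha⟩ => by
  obtain ⟨l, hl, -⟩ := h.satisfies ha
  simp at hl

/-! ### Decisions -/

/-- No conflict has occurred since the decision `d`: it has the greatest level, and its chunk
contains all literals that have not been propagated and meets the conflict clause. -/
structure FreshAt (s : State V) (d : Lit V) : Prop where
  mem : d ∈ s.trail
  decision : s.reason d.1 = none
  level : ∀ e ∈ s.trail, s.reason e.1 = none → e ≠ d → s.level e.1 < s.level d.1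
  queue : ∀ l ∈ s.trail, l ∉ s.propagated → d ∈ s.chunks l.1
  conflict : ∀ C, s.control = .conflict C → d ∈ s.chunksOf C

def Fresh (s : State V) : Prop := ∃ d, FreshAt s d

/-- The decisions of the trail. -/
noncomputable def decisions (s : State V) : Finset (Lit V) :=
  s.trail.toFinset.filter fun l => s.reason l.1 = none

-- Fresh states get `0`, so a decision does not raise the phase although it adds to `decisions`. In
-- other states, learning a known clause lowers the number of decisions.
open Classical in
noncomputable def phase (s : State V) : ℕ := if Fresh s then 0 else 1 + (decisions s).card

theorem mem_decisions {l : Lit V} : l ∈ decisions s ↔ l ∈ s.trail ∧ s.reason l.1 = none := by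
  simp [decisions]

theorem phase_le {t : State V} (h : Fresh s → Fresh t) (hd : decisions t ⊆ decisions s) :
    phase t ≤ phase s := by
  have := Finset.card_le_card hd
  unfold phase
  split_ifs with h1 h2 h2
  · omega
  · omega
  · exact absurd (h h2) h1
  · omega

theorem phase_lt_of_not_fresh {t : State V} (h : ¬ Fresh s) (hd : decisions t ⊂ decisions s) :
    phase t < phase s := by
  have := Finset.card_lt_card hd
  unfold phase
  rw [if_neg h]
  split_ifs <;> omega

theorem phase_le_of_fresh {t : State V} (h : Fresh t) : phase t ≤ phase s := by
  rw [phase, if_pos h]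
  exact Nat.zero_le _

/-- A change of the state that concerns neither the trail nor the propagated literals. -/
theorem FreshAt.congr {t : State V} {d : Lit V} (h : FreshAt s d) (h1 : t.trail = s.trail)
    (h2 : t.reason = s.reason) (h3 : t.level = s.level) (h4 : t.chunks = s.chunks)
    (h5 : s.propagated ⊆ t.propagated)
    (h6 : ∀ C, t.control = .conflict C → d ∈ s.chunksOf C) : FreshAt t d := by
  refine ⟨?_, ?_, ?_, ?_, ?_⟩
  · rw [h1]
    exact h.mem
  · rw [h2]
    exact h.decision
  · rw [h1, h2, h3]
    exact h.level
  · rw [h1, h4]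
    exact fun l hl hp => h.queue l hl fun hp' => hp (h5 hp')
  · simpa only [chunksOf, h4] using h6

/-- The literal `l` under propagation is in the queue, hence in the chunk of `d`; `neg l` is a
premise of `c`, so `c` inherits that chunk. -/
theorem FreshAt.imply {d : Lit V} (hf : FreshAt s d) {c l : Lit V} {C : Clause V}
    (hc : s.Unassigned c) (hl : l ∈ s.trail) (hp : l ∉ s.propagated) (hlC : neg l ∈ C)
    (hk : ∀ C, s.control ≠ .conflict C) : FreshAt (s.imply c C) d := by
  have hdc := hc.fst_ne hf.mem
  have hmem : ∀ m, m ∈ (s.imply c C).trail ↔ m ∈ s.trail ∨ m = c := by simp [State.imply]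
  refine ⟨(hmem d).2 (Or.inl hf.mem), by simpa [State.imply, hdc] using hf.decision, ?_, ?_, ?_⟩
  · intro e he her hed
    rcases (hmem e).1 he with he | rfl
    · have := hc.fst_ne he
      simp only [State.imply, ne_eq, this, hdc, not_false_eq_true, Function.update_of_ne] at her ⊢
      exact hf.level e he her hed
    · simp [State.imply] at her
  · intro m hm hmp
    rcases (hmem m).1 hm with hm | rfl
    · simpa [State.imply, hc.fst_ne hm] using hf.queue m hm hmp
    · simp only [State.imply, Function.update_self]
      refine mem_chunksOf.2 ⟨neg l, Finset.mem_erase.2 ⟨fun e => ?_, hlC⟩, hf.queue l hl hp⟩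
      exact hc.2 (by rwa [← e, neg_neg])
  · exact fun D hD => absurd hD (hk D)

theorem freshAt_decide (h : TrailInv s) {l : Lit V} (hl : s.Unassigned l) (hk : s.control = .loop)
    (hq : s.queue = []) : FreshAt (s.decide l) l := by
  have hmem : ∀ m, m ∈ (s.decide l).trail ↔ m ∈ s.trail ∨ m = l := by simp [State.decide]
  refine ⟨(hmem l).2 (Or.inr rfl), by simp [State.decide], ?_, ?_, ?_⟩
  · intro e he _ hel
    have he := ((hmem e).1 he).resolve_right hel
    have hle : s.level e.1 ≤ s.levelOf s.trail.toFinset :=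
      Finset.le_sup (f := fun l : Lit V => s.level l.1) (List.mem_toFinset.2 he)
    -- In `ℕ∞`, adding one is a strict increase only at finite values.
    have htop : s.levelOf s.trail.toFinset ≠ ⊤ := levelOf_ne_top fun k hk =>
      (h.level k (List.mem_toFinset.1 hk)).2
    simp only [State.decide, ne_eq, hl.fst_ne he, not_false_eq_true, Function.update_of_ne,
      Function.update_self]
    exact lt_of_le_of_lt hle (ENat.lt_add_one_iff htop |>.2 le_rfl)
  · intro m hm hmp
    rcases (hmem m).1 hm with hm | rfl
    · have : m ∈ s.queue := mem_queue.2 ⟨hm, hmp⟩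
      simp [hq] at this
    · simp [State.decide]
  · intro C hC
    have : s.control = .conflict C := hC
    simp [hk] at this

theorem decisions_imply {c : Lit V} {C : Clause V} (hc : s.Unassigned c) :
    decisions (s.imply c C) ⊆ decisions s := fun m hm => by
  obtain ⟨h1, h2⟩ := mem_decisions.1 hm
  rcases List.mem_append.1 h1 with h1 | h1
  · exact mem_decisions.2 ⟨h1, by simpa [State.imply, hc.fst_ne h1] using h2⟩
  · rw [List.mem_singleton.1 h1] at h2
    simp [State.imply] at h2

variable [Fintype V]

theorem TrailInv.length_le (h : TrailInv s) : s.trail.length ≤ Fintype.card V := by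
  simpa using h.map_fst_nodup.length_le_card

theorem TrailInv.total_iff (h : TrailInv s) :
    s.trail.length = Fintype.card V ↔ ∀ v, ∃ l ∈ s.trail, l.1 = v := by
  have hcard : (s.trail.map Prod.fst).toFinset.card = s.trail.length := by
    rw [List.toFinset_card_of_nodup h.map_fst_nodup, List.length_map]
  rw [← hcard, Finset.card_eq_iff_eq_univ, Finset.eq_univ_iff_forall]
  simp only [List.mem_toFinset, List.mem_map]

theorem TrailInv.exists_unassigned (h : TrailInv s) (hn : s.trail.length ≠ Fintype.card V) :
    ∃ l, s.Unassigned l := by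
  rw [ne_eq, h.total_iff] at hn
  push Not at hn
  obtain ⟨v, hv⟩ := hn
  exact ⟨(v, true), fun hm => hv _ hm rfl, fun hm => hv _ hm rfl⟩

/-- Every trail literal is propagated, so a long clause with a false watch has its other watch true;
`Small` handles the short clauses. -/
theorem Inv.sat (h : Inv F s) (hk : s.control = .sat) :
    ∃ a : V → Bool, (∀ l : Lit V, l ∈ s.trail ↔ a l.1 = l.2) ∧ Satisfies a F := by
  have hctl := h.control
  rw [hk] at hctl
  obtain ⟨hsmall, hq, hn⟩ := hctl
  have htot : ∀ l : Lit V, l ∈ s.trail ∨ neg l ∈ s.trail := fun l => by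
    obtain ⟨m, hm, hml⟩ := h.total_iff.1 hn l.1
    rcases eq_or_eq_neg hml with rfl | rfl
    · exact Or.inl hm
    · exact Or.inr hm
  have hprop : ∀ l ∈ s.trail, l ∈ s.propagated := fun l hl => by
    by_contra hcon
    have : l ∈ s.queue := mem_queue.2 ⟨hl, hcon⟩
    simp [hq] at this
  have ha : ∀ l : Lit V, l ∈ s.trail ↔ Decidable.decide ((l.1, true) ∈ s.trail) = l.2 := by
    rintro ⟨v, b⟩
    have h1 := htot (v, true)
    have h2 := h.consistent (v, true)
    cases b
    · simp only [decide_eq_false_iff_not]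
      exact ⟨fun h3 h4 => h2 h4 h3, fun h3 => h1.resolve_left h3⟩
    · simp
  refine ⟨fun v => Decidable.decide ((v, true) ∈ s.trail), ha, fun C hC => ?_⟩
  have hC' := h.input hC
  suffices ∃ l ∈ C, l ∈ s.trail by
    obtain ⟨l, hl, hlt⟩ := this
    exact ⟨l, hl, (ha l).1 hlt⟩
  by_cases hc : 2 ≤ C.card
  · obtain ⟨a, haC, b, hbC, -, hw⟩ := h.watched C hC' hc
    rcases htot a with hat | hat
    · exact ⟨a, haC, hat⟩
    · exact ⟨b, hbC, (h.other C hC' hc a b hw (hprop _ hat)).1⟩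
  · obtain ⟨l, hl, hlt, -⟩ := hsmall C hC' (by omega)
    exact ⟨l, hl, hlt⟩

/-! ### Progress -/

/-- The singleton of a chunk of greatest level in the conflict is a candidate by the level
alternative, and a finite nonempty family attains its least weight, whatever the signs. -/
theorem Base.exists_selected (h : Base F s) (ζ : Lit V → ℝ) {C : Clause V}
    (hfalse : ∀ m ∈ C, neg m ∈ s.trail) (hC : s.chunksOf C ≠ ∅) :
    ∃ G, s.IsSelected ζ C G := by
  have hcand : ∃ G, s.IsCandidate C G := by
    obtain ⟨d, hd, hmax⟩ := Finset.exists_mem_eq_sup (s.chunksOf C)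
      (Finset.nonempty_iff_ne_empty.2 hC) (fun d => s.level d.1)
    have hinter : {d} ∩ s.chunksOf C = {d} :=
      Finset.inter_eq_left.2 (Finset.singleton_subset_iff.2 hd)
    refine ⟨{d}, ?_, by rw [hinter, Finset.card_singleton], Or.inr ?_⟩
    · obtain ⟨m, hm, hdm⟩ := mem_chunksOf.1 hd
      exact Finset.singleton_subset_iff.2
        (mem_chunksOf.2 ⟨neg m, List.mem_toFinset.2 (hfalse m hm), hdm⟩)
    · rw [hinter, h.levelOf_eq hfalse]
      simp only [chunkLevel, Finset.sup_singleton]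
      exact hmax.symm
  obtain ⟨G, hG, hmin⟩ := Set.exists_min_image {G | s.IsCandidate C G} (s.weight ζ)
    (Set.toFinite _) hcand
  exact ⟨G, hG, hmin⟩

theorem Inv.final {ζ : Lit V → ℝ} (h : Inv F s) (hfin : Final ζ s) :
    s.control = .sat ∨ s.control = .unsat := by
  have hb := h.toBase
  have hctl := h.control
  cases hk : s.control with
  | sat => exact Or.inl rfl
  | unsat => exact Or.inr rfl
  | loop =>
    exfalso
    cases hq : s.queue with
    | nil =>
      by_cases hn : s.trail.length = Fintype.card V
      · exact hfin _ (.sat hk hq hn)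
      · obtain ⟨l, hl⟩ := h.exists_unassigned hn
        exact hfin _ (.decide hk hq hn hl)
    | cons l q => exact hfin _ (.start hk hq)
  | visit l P =>
    exfalso
    rw [hk] at hctl
    rcases P.eq_empty_or_nonempty with rfl | ⟨C, hC⟩
    · exact hfin _ (.finish hk)
    obtain ⟨g1, g2, g3⟩ := Finset.mem_filter.1 (hctl.2.todo hC)
    obtain ⟨c, hw⟩ : ∃ c, s.watch C = {neg l, c} := by
      obtain ⟨a, -, b, -, -, hw⟩ := hb.watched C g1 g2
      rw [hw] at g3
      rcases Finset.mem_insert.1 g3 with e | e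
      · exact ⟨b, by rw [hw, e]⟩
      · rw [Finset.mem_singleton] at e
        exact ⟨a, by rw [hw, e, Finset.pair_comm]⟩
    obtain ⟨h1, h2, h3, h4, h5, h6⟩ := hctl.2.inspect hb hC hw
    by_cases hskip : c ∈ s.trail ∧ s.chunks c.1 ⊆ s.cross l.1
    · exact hfin _ (.skip hk hC hw hskip)
    by_cases hq : ∃ q ∈ C, q ≠ c ∧ neg q ∉ s.trail
    · obtain ⟨r, hr, hrc, hrt⟩ := hq
      exact hfin _ (.replace hk hC hw hskip
        ⟨hr, hrc, fun _ => hrt, fun _ hp => hrt (hb.subset _ hp)⟩ hrt)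
    -- The old watch may always be kept when all literals except possibly `c` are false, since `l`
    -- is not yet propagated.
    · have hr : s.IsReplacement C c (neg l) :=
        ⟨h3, h5.symm, fun h => absurd h hq, fun _ => by simpa using hctl.2.notMem⟩
      have hrt : neg (neg l) ∈ s.trail := by simpa using hctl.2.mem
      by_cases hct : neg c ∈ s.trail
      · exact hfin _ (.conflict hk hC hw hskip hr hrt hct)
      by_cases hct' : c ∈ s.trail
      · exact hfin _ (.missed hk hC hw hskip hr hrt hct')
      · exact hfin _ (.imply hk hC hw hskip hr hrt ⟨hct', hct⟩)
  | conflict C =>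
    exfalso
    rw [hk] at hctl
    obtain ⟨h1, h2, -⟩ := hctl
    by_cases hC : s.chunksOf C = ∅
    · exact hfin _ (.unsat hk hC)
    obtain ⟨G, hG⟩ := hb.exists_selected ζ h2 hC
    obtain ⟨D, hD, -, hfalse, -, c, hc, hun, hiff⟩ := conflict_spec hb h1 h2 hG.1.2.1
    have huniq : ∀ m ∈ D, (s.undo G).Unassigned m ↔ m = c := fun m hm => by
      refine ⟨fun hm' => (hiff m hm).1 ?_, fun e => e ▸ hun⟩
      by_contra hcon
      exact hm'.2 (hb.mem_undo.2 ⟨hfalse m hm, hcon⟩)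
    by_cases hcard : 2 ≤ D.card
    · obtain ⟨c₁, hc₁, hne⟩ := Finset.exists_mem_ne (by omega : 1 < D.card) c
      exact hfin _ (.learn hk hC hG hD huniq hc hcard hc₁ hne)
    · exact hfin _ (.learnUnit hk hC hG hD huniq hc (by omega))

/-! ### Termination -/

/-- The first conflict after a decision produces a new clause. -/
theorem Inv.notMem_of_fresh (h : Inv F s) (hf : Fresh s) {C D : Clause V}
    {G : Finset (Chunk V)} (hk : s.control = .conflict C) (hC : s.chunksOf C ≠ ∅)
    (hG : s.IsCandidate C G) (hD : s.analyze C G = some D) : D ∉ s.clauses := by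
  intro hDc
  have hctl := h.control
  rw [hk] at hctl
  obtain ⟨h1, h2, h3⟩ := hctl
  obtain ⟨d, hd⟩ := hf
  obtain ⟨D', hD', -, hfalse, -, c, hc, -, hiff⟩ := conflict_spec h.toBase h1 h2 hG.2.1
  obtain rfl : D = D' := Option.some_injective _ (hD.symm.trans hD')
  -- As `D` is known, the chunk in which `G` meets the conflict has the level of `C`. The chunk of
  -- `d` also meets `C` and has strictly the greatest level, so the two chunks coincide.
  have hlev := hG.2.2.resolve_left fun hn => hn ⟨D, hDc, hD⟩
  obtain ⟨e, he⟩ := Finset.card_eq_one.1 hG.2.1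
  obtain ⟨heG, heC⟩ := Finset.mem_inter.1 (he ▸ Finset.mem_singleton_self e :
    e ∈ G ∩ s.chunksOf C)
  have hdG : d ∈ G := by
    suffices e = d from this ▸ heG
    by_contra hne
    obtain ⟨m, hm, hem⟩ := mem_chunksOf.1 heC
    obtain ⟨g1, g2, -⟩ := h.chunk (neg m) (h2 m hm) e hem
    have hlt := hd.level e g1 g2 hne
    rw [he, h.levelOf_eq h2] at hlev
    simp only [chunkLevel, Finset.sup_singleton] at hlev
    have hle : s.level d.1 ≤ (s.chunksOf C).sup (fun d => s.level d.1) :=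
      Finset.le_sup (f := fun d : Lit V => s.level d.1) (hd.conflict C hk)
    rw [← hlev] at hle
    exact absurd hlt (not_lt.2 hle)
  by_cases hcard : 2 ≤ D.card
  -- A watch of the falsified clause `D` cannot have been propagated, as the other watch would be
  -- true; so it lies in the chunk of `d ∈ G` and is the unique literal touching `G`. But there are
  -- two watches.
  · have key : ∀ a b, a ∈ D → b ∈ D → s.watch D = {a, b} → a = c := fun a b ha hb hw => by
      have hp : neg a ∉ s.propagated := fun hp =>
        h.consistent b (h.other D hDc hcard a b hw hp).1 (hfalse b hb)
      exact (hiff a ha).1 (touches_iff.2 ⟨d, hd.queue (neg a) (hfalse a ha) hp, hdG⟩)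
    obtain ⟨a, ha, b, hb, hab, hw⟩ := h.watched D hDc hcard
    exact hab ((key a b ha hb hw).trans
      (key b a hb ha (by rw [hw, Finset.pair_comm])).symm)
  · obtain ⟨l, hl, hlt, -⟩ := h3.resolve_right hC D hDc (by omega)
    exact h.consistent l hlt (hfalse l hl)

/-- The constants order the program points: a visit starts with at most all clauses, so `loop` lies
above it; a conflict lies below every visit and above the final states. -/
def rank (s : State V) : Control V → ℕ
  | .loop => s.clauses.card + 3
  | .visit _ P => P.card + 2
  | .conflict _ => 1
  | .sat => 0
  | .unsat => 0

/-- The termination measure. -/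
noncomputable def progress (s : State V) : ℕ ×ₗ ℕ ×ₗ ℕ ×ₗ ℕ ×ₗ ℕ :=
  toLex (Fintype.card (Clause V) - s.clauses.card, toLex (phase s,
    toLex (Fintype.card V - s.trail.length,
      toLex (Fintype.card (Lit V) - s.propagated.card, rank s s.control))))

theorem progress_lt_iff {t : State V} : progress t < progress s ↔
    Fintype.card (Clause V) - t.clauses.card < Fintype.card (Clause V) - s.clauses.card ∨
    Fintype.card (Clause V) - t.clauses.card = Fintype.card (Clause V) - s.clauses.card ∧
    (phase t < phase s ∨ phase t = phase s ∧
    (Fintype.card V - t.trail.length < Fintype.card V - s.trail.length ∨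
    Fintype.card V - t.trail.length = Fintype.card V - s.trail.length ∧
    (Fintype.card (Lit V) - t.propagated.card < Fintype.card (Lit V) - s.propagated.card ∨
    Fintype.card (Lit V) - t.propagated.card = Fintype.card (Lit V) - s.propagated.card ∧
    rank t t.control < rank s s.control))) := by
  simp only [progress, Prod.Lex.toLex_lt_toLex]

theorem progress_lt_of_rank {t : State V} (h1 : t.clauses = s.clauses) (h2 : phase t ≤ phase s)
    (h3 : t.trail = s.trail) (h4 : t.propagated = s.propagated)
    (h5 : rank t t.control < rank s s.control) : progress t < progress s := by
  rw [progress_lt_iff, h1, h3, h4]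
  omega

theorem progress_lt_of_trail {t : State V} (h1 : t.clauses = s.clauses) (h2 : phase t ≤ phase s)
    (h3 : t.trail.length = s.trail.length + 1) (h4 : t.trail.length ≤ Fintype.card V) :
    progress t < progress s := by
  rw [progress_lt_iff, h1]
  omega

theorem progress_lt_of_propagated {t : State V} (h1 : t.clauses = s.clauses)
    (h2 : phase t ≤ phase s) (h3 : t.trail = s.trail)
    (h4 : t.propagated.card = s.propagated.card + 1) : progress t < progress s := by
  have := Finset.card_le_univ t.propagated
  rw [progress_lt_iff, h1, h3]
  omega

/-- Learning makes progress. -/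
theorem Inv.progress_learn {t : State V} (h : Inv F s) {C D : Clause V} {G : Finset (Chunk V)}
    {c : Lit V} (hk : s.control = .conflict C) (hC : s.chunksOf C ≠ ∅) (hG : s.IsCandidate C G)
    (hD : s.analyze C G = some D) (hc : (s.undo G).Unassigned c)
    (ht : t.clauses = insert D s.clauses) (hd : decisions t ⊆ decisions ((s.undo G).imply c D)) :
    progress t < progress s := by
  have hctl := h.control
  rw [hk] at hctl
  by_cases hDc : D ∈ s.clauses
  · have hf : ¬ Fresh s := fun hf => h.notMem_of_fresh hf hk hC hG hD hDc
    have hlt : decisions t ⊂ decisions s := by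
      have hsub := hd.trans (decisions_imply hc)
      have hsub' : ∀ m ∈ decisions t, m ∈ decisions s ∧ ¬ s.Touches G m := fun m hm => by
        obtain ⟨h1, h2⟩ := mem_decisions.1 (hsub hm)
        obtain ⟨h3, h4⟩ := h.mem_undo.1 h1
        exact ⟨mem_decisions.2 ⟨h3, h.toBase.undo_reason h1 ▸ h2⟩, h4⟩
      -- The decision naming the chunk common to `G` and the conflict is on the trail and gets
      -- undone, which makes the inclusion strict.
      obtain ⟨e, he⟩ := Finset.card_eq_one.1 hG.2.1
      obtain ⟨heG, heC⟩ := Finset.mem_inter.1 (he ▸ Finset.mem_singleton_self e :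
        e ∈ G ∩ s.chunksOf C)
      obtain ⟨m, hm, hem⟩ := mem_chunksOf.1 heC
      obtain ⟨g1, g2, -⟩ := h.chunk (neg m) (hctl.2.1 m hm) e hem
      refine (Finset.ssubset_iff_of_subset fun m hm => (hsub' m hm).1).2
        ⟨e, mem_decisions.2 ⟨g1, g2⟩, fun het => (hsub' e het).2 ?_⟩
      exact touches_iff.2 ⟨e, by simp [h.decision e g1 g2], heG⟩
    rw [progress_lt_iff, ht, Finset.insert_eq_of_mem hDc]
    exact Or.inr ⟨rfl, Or.inl (phase_lt_of_not_fresh hf hlt)⟩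
  · rw [progress_lt_iff, ht, Finset.card_insert_of_notMem hDc]
    have := Finset.card_le_univ (insert D s.clauses)
    rw [Finset.card_insert_of_notMem hDc] at this
    omega

theorem Inv.progress_lt {ζ : Lit V → ℝ} {s' : State V} (h : Inv F s) (hstep : Step ζ s s') :
    progress s' < progress s := by
  have hlen := (h.step hstep).length_le
  have hctl := h.control
  cases hstep with
  | sat hk hq hn =>
    refine progress_lt_of_rank rfl (phase_le (fun ⟨d, hd⟩ => ⟨d, ?_⟩) subset_rfl) rfl rfl ?_
    · exact hd.congr rfl rfl rfl rfl subset_rfl (by simp [goto])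
    · simp [goto, rank, hk]
  | decide hk hq hn hl =>
    exact progress_lt_of_trail rfl (phase_le_of_fresh ⟨_, freshAt_decide h.toTrailInv hl hk hq⟩)
      (by simp [State.decide]) hlen
  | @start l q hk hq =>
    refine progress_lt_of_rank rfl (phase_le (fun ⟨d, hd⟩ => ⟨d, ?_⟩) subset_rfl) rfl rfl ?_
    · exact hd.congr rfl rfl rfl rfl subset_rfl (by simp [goto])
    · have : (s.watchList (neg l)).card ≤ s.clauses.card :=
        Finset.card_le_card (Finset.filter_subset _ _)
      simp only [goto, rank, hk]
      omega
  | @finish l hk =>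
    rw [hk] at hctl
    have hph : phase (State.goto { s with propagated := insert l s.propagated } .loop) ≤
        phase s := by
      refine phase_le (fun ⟨d, hd⟩ => ⟨d, ?_⟩) subset_rfl
      exact hd.congr rfl rfl rfl rfl (Finset.subset_insert _ _) (by simp [goto])
    exact progress_lt_of_propagated rfl hph rfl
      (Finset.card_insert_of_notMem hctl.2.notMem)
  | skip hk hC hw hc =>
    refine progress_lt_of_rank rfl (phase_le (fun ⟨d, hd⟩ => ⟨d, ?_⟩) subset_rfl) rfl rfl ?_
    · exact hd.congr rfl rfl rfl rfl subset_rfl (by simp [goto])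
    · simp only [goto, rank, hk]
      have := Finset.card_erase_lt_of_mem hC
      omega
  | replace hk hC hw hskip hr hrt =>
    refine progress_lt_of_rank rfl (phase_le (fun ⟨d, hd⟩ => ⟨d, ?_⟩) subset_rfl) rfl rfl ?_
    · exact hd.congr rfl rfl rfl rfl subset_rfl (by simp [goto])
    · simp only [goto, rank, hk]
      have := Finset.card_erase_lt_of_mem hC
      omega
  | @conflict l c r P C hk hC hw hskip hr hrt hct =>
    rw [hk] at hctl
    have hlC := (hctl.2.inspect h.toBase hC hw).2.2.1
    refine progress_lt_of_rank rfl (phase_le (fun ⟨d, hd⟩ => ⟨d, ?_⟩) subset_rfl) rfl rfl ?_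
    · refine hd.congr rfl rfl rfl rfl subset_rfl fun D hD => ?_
      obtain rfl : C = D := by simpa [goto] using hD
      -- The conflict clause contains the complement of the queued literal `l`, which lies in the
      -- chunk of `d`.
      exact mem_chunksOf.2 ⟨neg l, hlC, hd.queue l hctl.2.mem hctl.2.notMem⟩
    · simp only [goto, rank, hk]
      omega
  | missed hk hC hw hskip hr hrt hct =>
    refine progress_lt_of_rank rfl (phase_le (fun ⟨d, hd⟩ => ⟨d, ?_⟩) subset_rfl) rfl rfl ?_
    · exact hd.congr rfl rfl rfl rfl subset_rfl (by simp [goto])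
    · simp only [goto, rank, hk]
      have := Finset.card_erase_lt_of_mem hC
      omega
  | @imply l c r P C hk hC hw hskip hr hrt hct =>
    rw [hk] at hctl
    have hlC := (hctl.2.inspect h.toBase hC hw).2.2.1
    refine progress_lt_of_trail rfl (phase_le (fun ⟨d, hd⟩ => ⟨d, ?_⟩)
      (decisions_imply (C := C) hct)) (by simp [State.imply, goto, setWatch, addCross])
      hlen
    exact (FreshAt.imply hd hct hctl.2.mem hctl.2.notMem hlC (by simp [hk])).congr
      rfl rfl rfl rfl subset_rfl (by simp [goto])
  | unsat hk hC =>
    refine progress_lt_of_rank rfl (phase_le (fun ⟨d, hd⟩ => ⟨d, ?_⟩) subset_rfl) rfl rfl ?_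
    · exact hd.congr rfl rfl rfl rfl subset_rfl (by simp [goto])
    · simp [goto, rank, hk]
  | @learnUnit C D G c hk hC hG hD huniq hc hcard =>
    exact h.progress_learn hk hC hG.1 hD ((huniq c hc).2 rfl)
      (congrArg (insert D) (h.toBase.undo_clauses G)) subset_rfl
  | @learn C D G c₁ c hk hC hG hD huniq hc hcard hc₁ hne =>
    exact h.progress_learn hk hC hG.1 hD ((huniq c hc).2 rfl)
      (congrArg (insert D) (h.toBase.undo_clauses G)) subset_rfl

theorem not_exists_infinite (ζ : Lit V → ℝ) (F : CNF V) :
    ¬ ∃ r : ℕ → State V, Initial F (r 0) ∧ ∀ n, Step ζ (r n) (r (n + 1)) := by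
  rintro ⟨r, h0, hr⟩
  have hinv : ∀ n, Inv F (r n) := fun n => by
    induction n with
    | zero => exact .initial h0
    | succ n ih => exact ih.step (hr n)
  have hanti : StrictAnti fun n => progress (r n) :=
    strictAnti_nat_of_succ_lt fun n => (hinv n).progress_lt (hr n)
  exact not_strictAnti_of_wellFoundedLT _ hanti

/-! ### Initial states -/

/-- When both unit clauses on a variable occur, the positive literal is assigned and the negative
clause can serve as first conflict. The empty clause is falsified vacuously. -/
theorem exists_initial (F : CNF V) : ∃ s : State V, Initial F s := by
  classical
  let U : Finset (Lit V) := Finset.univ.filter fun l => {l} ∈ F ∧ (l.2 = true ∨ {neg l} ∉ F)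
  have hU : ∀ l, l ∈ U ↔ {l} ∈ F ∧ (l.2 = true ∨ {neg l} ∉ F) := fun l => by simp [U]
  have hUneg : ∀ l ∈ U, neg l ∉ U := fun l hl hl' => by
    rw [hU] at hl hl'
    rw [neg_neg] at hl'
    have h1 := hl.2.resolve_right fun h => h hl'.1
    have h2 := hl'.2.resolve_right fun h => h hl.1
    simp [neg, h1] at h2
  have hwatch : ∀ C : Clause V, ∃ w : Finset (Lit V), 2 ≤ C.card →
      ∃ a ∈ C, ∃ b ∈ C, a ≠ b ∧ w = {a, b} := fun C => by
    by_cases hc : 2 ≤ C.card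
    · obtain ⟨a, ha, b, hb, hab⟩ := Finset.one_lt_card.1 hc
      exact ⟨{a, b}, fun _ => ⟨a, ha, b, hb, hab, rfl⟩⟩
    · exact ⟨∅, fun h => absurd h hc⟩
  choose w hw using hwatch
  have hctl : ∃ k : Control V, (k = .loop ∧ ∀ C ∈ F, C.card ≤ 1 → ∃ l ∈ C, l ∈ U.toList) ∨
      (∃ C ∈ F, C.card ≤ 1 ∧ (∀ l ∈ C, neg l ∈ U.toList) ∧ k = .conflict C) := by
    by_cases hc : ∀ C ∈ F, C.card ≤ 1 → ∃ l ∈ C, l ∈ U.toList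
    · exact ⟨_, Or.inl ⟨rfl, hc⟩⟩
    · push Not at hc
      obtain ⟨C, hC, hcard, hl⟩ := hc
      refine ⟨.conflict C, Or.inr ⟨C, hC, hcard, fun l hlC => ?_, rfl⟩⟩
      obtain rfl : {l} = C := Finset.eq_of_subset_of_card_le
        (Finset.singleton_subset_iff.2 hlC) (by simpa using hcard)
      have hlU := hl l hlC
      rw [Finset.mem_toList, hU] at hlU ⊢
      have h1 : ¬ (l.2 = true ∨ {neg l} ∉ F) := fun h => hlU ⟨hC, h⟩
      push Not at h1
      exact ⟨h1.2, Or.inl (by simpa [neg] using h1.1)⟩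
  obtain ⟨k, hk⟩ := hctl
  -- Justifications and levels are stored per variable, so the assigned literal must be recovered
  -- from its variable.
  let val : V → Option (Lit V) := fun v =>
    if (v, true) ∈ U then some (v, true) else if (v, false) ∈ U then some (v, false) else none
  have hval : ∀ l ∈ U, val l.1 = some l := by
    rintro ⟨v, b⟩ hl
    cases b
    · have : (v, true) ∉ U := hUneg _ hl
      simp [val, this, hl]
    · simp [val, hl]
  have hval' : ∀ l, l ∉ U → neg l ∉ U → val l.1 = none := by
    rintro ⟨v, b⟩ h1 h2
    cases b
    · have h2 : (v, true) ∉ U := h2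
      simp [val, h1, h2]
    · have h2 : (v, false) ∉ U := h2
      simp [val, h1, h2]
  refine ⟨{ clauses := F, trail := U.toList, propagated := ∅,
            reason := fun v => (val v).map fun l => {l},
            level := fun v => if (val v).isSome then 0 else ⊤,
            chunks := fun _ => ∅, cross := fun _ => ∅, watch := w, control := k },
    rfl, rfl, fun _ => rfl, fun _ => rfl, fun C _ hc => hw C hc, U.nodup_toList, ?_, ?_, ?_, hk⟩
  · intro l hl
    rw [Finset.mem_toList] at hl
    exact ⟨((hU l).1 hl).1, by simpa using hUneg l hl⟩
  · intro l hl
    rw [Finset.mem_toList] at hl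
    simp [hval l hl]
  · rintro l ⟨h1, h2⟩
    simp only [Finset.mem_toList] at h1 h2
    simp [hval' l h1 h2]

end GraphBT

/-! ### The main theorem -/

open GraphBT
theorem theorem1 {V : Type*} [Fintype V] [DecidableEq V] (ζ : Lit V → ℝ) (F : CNF V) :
    -- the algorithm can be started on every formula
    (∃ s : State V, Initial F s) ∧
    -- soundness
    (∀ s : State V, Reachable ζ F s → s.control = .sat →
      ∃ a : V → Bool, (∀ l : Lit V, l ∈ s.trail ↔ a l.1 = l.2) ∧ Satisfies a F) ∧
    (∀ s : State V, Reachable ζ F s → s.control = .unsat → Derivable F ∅ ∧ ¬ Satisfiable F) ∧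
    -- completeness
    (Satisfiable F → ∀ s : State V, Reachable ζ F s → Final ζ s → s.control = .sat) ∧
    (¬ Satisfiable F → ∀ s : State V, Reachable ζ F s → Final ζ s → s.control = .unsat) ∧
    -- termination
    (¬ ∃ r : ℕ → State V, Initial F (r 0) ∧ ∀ n, Step ζ (r n) (r (n + 1))) := by
  have hunsat : ∀ s : State V, Reachable ζ F s → s.control = .unsat → Derivable F ∅ :=
    fun s hs hk => by
      have hctl := (Inv.of_reachable hs).control
      rw [hk] at hctl
      exact hctl
  refine ⟨exists_initial F, fun s hs hk => (Inv.of_reachable hs).sat hk,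
    fun s hs hk => ⟨hunsat s hs hk, (hunsat s hs hk).not_satisfiable⟩, fun hF s hs hfin => ?_,
    fun hF s hs hfin => ?_, not_exists_infinite ζ F⟩
  · exact ((Inv.of_reachable hs).final hfin).resolve_right fun hk =>
      (hunsat s hs hk).not_satisfiable hF
  · refine ((Inv.of_reachable hs).final hfin).resolve_left fun hk => hF ?_
    obtain ⟨a, -, ha⟩ := (Inv.of_reachable hs).sat hk
    exact ⟨a, ha⟩
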